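/- Let $(R,\mathfrak m,k)$ be a Noetherian local ring of dimension $d\ge 1$ with infinite residue field $k$; write $\lambda$ for length. Let $I$ be an ideal of $R$ of analytic spread $\ell(I)=\dim(G/\mathfrak mG)=d$, where $G=\bigoplus_{n\ge0}I^n/I^{n+1}$, satisfying the condition $G_d$: for every prime $\mathfrak p\supseteq I$ with $\operatorname{ht}\mathfrak p=i\le d-1$, the ideal $I_{\mathfrak p}$ is generated by (the images of) $i$ elements of $I$. Let $x_1,\dots,x_d$ be general elements of $I$; that is, for every generating set $a_1,\dots,a_t$ of $I$ there is a Zariski dense open subset $U\subseteq k^{dt}$ such that what follows holds for all $x_i=\sum_{j=1}^t\lambda_{ij}a_j$ with $(\lambda_{ij})\in R^{dt}$ whose image in $k^{dt}$ lies in $U$. Put $J=(x_1,\dots,x_d)$, $J_{d-1}=(x_1,\dots,x_{d-1})$, $K=J_{d-1}:I^\infty=\{a\in R: aI^t\subseteq J_{d-1}\text{ for some }t>0\}$, $\overline R=R/K$ and $\overline I=I\overline R$. Then $\overline R$ is a local ring of dimension $1$ with maximal ideal $\overline{\mathfrak m}=\sqrt{\overline I}$. Let $H_{\overline I}(n)=\sum_{i=0}^n\lambda(H^0_{\overline{\mathfrak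 m}}(\overline I^{\,i}/\overline I^{\,i+1}))$ be the (generalized) Hilbert–Samuel function of $\overline I$, with $H_{\overline I}(n)=0$ for $n<0$ (since $\overline I$ is $\overline{\mathfrak m}$-primary, $H_{\overline I}(n)=\lambda(\overline R/\overline I^{\,n+1})$ for $n\ge0$). There are unique integers $e_0(\overline I),e_1(\overline I)$ such that the polynomial $P_{\overline I}(n)=e_0(\overline I)(n+1)-e_1(\overline I)$ equals $H_{\overline I}(n)$ for all $n\gg0$. With $\Delta[f(n)]=f(n)-f(n-1)$, all lengths below are finite and: (a) for every $n\ge0$, $$\lambda(I^{n+1}/JI^n)-\lambda\big[(K\cap I^{n+1})/(K\cap JI^n)\big]=\Delta\big[P_{\overline I}(n)-H_{\overline I}(n)\big];$$ (b) $$\sum_{n=0}^\infty\Big(\lambda(I^{n+1}/JI^n)-\lambda\big[(K\cap I^{n+1})/(K\cap JI^n)\big]\Big)=e_1(\overline I).$$ -/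

import Mathlib

universe u

/-! ### General elements of an ideal -/

/-- `U ⊆ k^σ` is Zariski open: it is the complement of the common zero set of some set of
polynomials. -/
def IsZariskiOpen {k : Type*} [Field k] {σ : Type*} (U : Set (σ → k)) : Prop :=
  ∃ S : Set (MvPolynomial σ k), U = {v | ∃ f ∈ S, MvPolynomial.eval v f ≠ 0}

/-- `U ⊆ k^σ` is Zariski dense: it meets every nonempty Zariski open set. -/
def IsZariskiDense {k : Type*} [Field k] {σ : Type*} (U : Set (σ → k)) : Prop :=
  ∀ V : Set (σ → k), IsZariskiOpen V → V.Nonempty → (U ∩ V).Nonempty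

/-- "For general elements `x₁, …, x_s` in `I`, the property `P` holds": for every finite generating
sequence `a₁, …, a_t` of `I` there is a Zariski dense open subset `U` of `k^{st}`, `k` the residue
field, such that `P` holds for all `x_i = ∑_j c_{ij} a_j` for which the image of `(c_{ij})` in
`k^{st}` lies in `U`. -/
def ForGeneralElements {R : Type u} [CommRing R] [IsLocalRing R] (I : Ideal R) (s : ℕ)
    (P : (Fin s → R) → Prop) : Prop :=
  ∀ (t : ℕ) (a : Fin t → R), Ideal.span (Set.range a) = I →
    ∃ U : Set (Fin s × Fin t → IsLocalRing.ResidueField R),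
      IsZariskiOpen U ∧ IsZariskiDense U ∧
        ∀ c : Fin s × Fin t → R, (fun q => IsLocalRing.residue R (c q)) ∈ U →
          P (fun i => ∑ j, c (i, j) * a j)

/-! ### Analytic spread and the condition `G_s` -/

/-- The associated graded ring `gr_I(R) = ⊕ Iⁿ/Iⁿ⁺¹`, as `R[It] / I R[It]`. -/
def AssociatedGradedRing {R : Type u} [CommRing R] (I : Ideal R) : Type u :=
  reesAlgebra I ⧸ I.map (algebraMap R (reesAlgebra I))

noncomputable instance {R : Type u} [CommRing R] (I : Ideal R) :
    CommRing (AssociatedGradedRing I) :=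
  Ideal.Quotient.commRing (I.map (algebraMap R (reesAlgebra I)))

noncomputable instance {R : Type u} [CommRing R] (I : Ideal R) :
    Algebra R (AssociatedGradedRing I) :=
  Ideal.Quotient.algebra R (I := I.map (algebraMap R (reesAlgebra I)))

/-- The special fiber ring `G / 𝔪G`, where `G = gr_I(R)`. -/
abbrev SpecialFiberRing {R : Type u} [CommRing R] [IsLocalRing R] (I : Ideal R) : Type u :=
  AssociatedGradedRing I ⧸
    (IsLocalRing.maximalIdeal R).map (algebraMap R (AssociatedGradedRing I))

/-- The analytic spread `ℓ(I)`: the Krull dimension of the special fiber ring. -/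
noncomputable def analyticSpread {R : Type u} [CommRing R] [IsLocalRing R] (I : Ideal R) :
    WithBot ℕ∞ :=
  ringKrullDim (SpecialFiberRing I)

/-- The condition `G_s`: for every prime `p ⊇ I` of height `i < s`, there are `i` elements of `I`
that generate the ideal `I_p` of the localization `R_p`. -/
def SatisfiesG {R : Type u} [CommRing R] (I : Ideal R) (s : ℕ) : Prop :=
  ∀ (p : Ideal R) [p.IsPrime], I ≤ p → ∀ i : ℕ, p.height = i → i < s →
    ∃ y : Fin i → R, (∀ j, y j ∈ I) ∧
      I.map (algebraMap R (Localization.AtPrime p)) =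
        (Ideal.span (Set.range y)).map (algebraMap R (Localization.AtPrime p))

/-! ### Colon ideals, lengths of subquotients -/

/-- The ideal `(x₁, …, x_i)` generated by the first `i` members of a finite sequence. -/
def initialIdeal {R : Type u} [CommRing R] {s : ℕ} (x : Fin s → R) (i : ℕ) : Ideal R :=
  Ideal.span {y | ∃ j : Fin s, (j : ℕ) < i ∧ y = x j}

/-- `J : I^∞ = {a | ∃ t > 0, a Iᵗ ⊆ J}`. -/
def colonPowers {R : Type u} [CommRing R] (J I : Ideal R) : Ideal R where
  carrier := {a | ∃ t : ℕ, 0 < t ∧ ∀ b ∈ I ^ t, a * b ∈ J}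
  zero_mem' := ⟨1, one_pos, fun b _ => by simp⟩
  add_mem' := by
    rintro a a' ⟨t, ht, h⟩ ⟨t', -, h'⟩
    refine ⟨t + t', by omega, fun b hb => ?_⟩
    rw [add_mul]
    exact J.add_mem (h b (Ideal.pow_le_pow_right (by omega) hb))
      (h' b (Ideal.pow_le_pow_right (by omega) hb))
  smul_mem' := by
    rintro c a ⟨t, ht, h⟩
    refine ⟨t, ht, fun b hb => ?_⟩
    rw [smul_eq_mul, mul_assoc]
    exact J.mul_mem_left c (h b hb)

/-- The ideal `J_{d-1} : I^∞`, where `J_{d-1} = (x₁, …, x_{d-1})` (meant for `d ≥ 1`). -/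
abbrev residualIdeal {R : Type u} [CommRing R] (I : Ideal R) {d : ℕ} (x : Fin d → R) : Ideal R :=
  colonPowers (initialIdeal x (d - 1)) I

/-- The image `Ī` of `I` in `R̄ = R / (J_{d-1} : I^∞)`. -/
abbrev imageIdeal {R : Type u} [CommRing R] (I : Ideal R) {d : ℕ} (x : Fin d → R) :
    Ideal (R ⧸ residualIdeal I x) :=
  I.map (Ideal.Quotient.mk (residualIdeal I x))

/-- The ideal `J = (x₁, …, x_d)`. -/
abbrev fullIdeal {R : Type u} [CommRing R] {d : ℕ} (x : Fin d → R) : Ideal R :=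
  Ideal.span (Set.range x)

/-- The quotient module `M / N` of two ideals (meant for `N ⊆ M`). -/
abbrev SubQuotient {R : Type u} [CommRing R] (M N : Ideal R) : Type u :=
  M ⧸ Submodule.comap M.subtype N

/-- The length `λ(M / N)` of the quotient of two ideals (meant for `N ⊆ M`). -/
noncomputable def quotLength {R : Type u} [CommRing R] (M N : Ideal R) : ℕ∞ :=
  Module.length R (SubQuotient M N)

/-! ### The generalized Hilbert-Samuel function, polynomial and coefficients -/

/-- `Γ_𝔪(M) = H⁰_𝔪(M)`: the submodule of the elements of `M` killed by a power of `𝔪`. -/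
def gammaM (A : Type u) [CommRing A] [IsLocalRing A] (M : Type u) [AddCommGroup M] [Module A M] :
    Submodule A M where
  carrier := {ξ | ∃ t : ℕ, 0 < t ∧ ∀ r ∈ IsLocalRing.maximalIdeal A ^ t, r • ξ = 0}
  zero_mem' := ⟨1, one_pos, fun r _ => smul_zero r⟩
  add_mem' := by
    rintro x y ⟨t, ht, h⟩ ⟨t', -, h'⟩
    refine ⟨t + t', by omega, fun r hr => ?_⟩
    rw [smul_add, h r (Ideal.pow_le_pow_right (by omega) hr),
      h' r (Ideal.pow_le_pow_right (by omega) hr), add_zero]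
  smul_mem' := by
    rintro c x ⟨t, ht, h⟩
    refine ⟨t, ht, fun r hr => ?_⟩
    rw [smul_comm, h r hr, smul_zero]

/-- The generalized Hilbert-Samuel function `H_I(n) = ∑_{i=0}^n λ(Γ_𝔪(Iⁱ/Iⁱ⁺¹))`; the sum is empty,
so `H_I(n) = 0`, for `n < 0`. (The lengths are finite if the local ring `A` is Noetherian.) -/
noncomputable def generalizedHilbertFunction {A : Type u} [CommRing A] [IsLocalRing A]
    (I : Ideal A) (n : ℤ) : ℕ :=
  ∑ i ∈ Finset.range (n + 1).toNat,
    (Module.length A (gammaM A (SubQuotient (I ^ i) (I ^ (i + 1))))).toNat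

/-- The polynomial `∑_{i=0}^D (-1)ⁱ j_i binom(n + D - i, D - i)` in `n`;
`Polynomial.preHilbertPoly ℚ m 0` is the polynomial `binom(n + m, m)`. -/
noncomputable def polynomialOfCoeffs (D : ℕ) (j : ℕ → ℤ) : Polynomial ℚ :=
  ∑ i ∈ Finset.range (D + 1),
    Polynomial.C ((-1) ^ i * (j i : ℚ)) * Polynomial.preHilbertPoly ℚ (D - i) 0

/-- `A` has dimension `D` and `j₀, …, j_D` are the generalized Hilbert coefficients of `I`, that is,
`∑_{i=0}^D (-1)ⁱ j_i binom(n + D - i, D - i)` is the generalized Hilbert-Samuel polynomial `P_I(n)`,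
the one that agrees with `H_I(n)` for all large `n`. -/
def AreGeneralizedHilbertCoeffs {A : Type u} [CommRing A] [IsLocalRing A] (I : Ideal A) (D : ℕ)
    (j : ℕ → ℤ) : Prop :=
  ringKrullDim A = D ∧
    ∀ᶠ n : ℕ in Filter.atTop,
      (generalizedHilbertFunction I n : ℚ) = (polynomialOfCoeffs D j).eval (n : ℚ)

/-- The difference operator `Δ[f(n)] = f(n) - f(n - 1)`. -/
def backwardDiff (f : ℤ → ℚ) (n : ℤ) : ℚ := f n - f (n - 1)

/-!
Let `J = (x₁, …, x_d)`, `J_{d-1} = (x₁, …, x_{d-1})`, `K = J_{d-1} : I^∞` and `R̄ = R / K`. Three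
facts about general elements carry the proof.

* `J` is a reduction of `I`. By prime avoidance with linear forms, `d = ℓ(I)` suitable elements
  generate an ideal of the special fiber ring which is primary to the irrelevant ideal
  (`exists_pow_succ_le`), and by Nakayama's lemma in a polynomial ring this persists for general
  elements (`exists_polynomial_pow_succ_eq`).
* `J_{d-1}` and `I` agree on the punctured spectrum: `𝔪ˢ ⊆ I + (J_{d-1} : I)`. Adding a generic
  linear combination of the generators of `I` lowers the number of local generators of
  `I / (x₁, …, x_i)` at a prime, unless the height of that prime has gone up; so the bound
  `ht P - i` is preserved (`ResidualGeneratorBound.step`), and after `d - 1` steps it vanishes at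
  all primes properly contained in `𝔪 R[Z]`. The resulting inclusion over `R[Z]`, with a factor
  `f ∉ 𝔪 R[Z]`, is specialized at all `c` at which `f` is a unit
  (`exists_polynomial_pow_le_sup_colon`).
* `K ≠ R` (`residualIdeal_ne_top`). Otherwise a power of `𝔪` multiplies `x_d` into `J_{d-1}`. The
  Rees algebra `R[It]` is finite over `R[T₁, …, T_d]`, `Tᵢ ↦ xᵢ t`, and since `ℓ(I) = d` it has a
  prime `P` over `𝔪 R[T]`; going up yields a prime `Q ⊇ P` over `(𝔪, T₁, …, T_{d-1})` with
  `ht Q ≥ ht P + d - 1`. But `Q` is minimal over `(x₁ t, …, x_{d-1} t)`, so `ht Q ≤ d - 1` by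
  Krull's height theorem. Hence `P` is a minimal prime of `R[It]` that contains `x_d`, and therefore
  also `x_d t`, which is absurd because `T_d ∉ 𝔪 R[T]`.

It follows that `R̄` is a one-dimensional Cohen–Macaulay local ring in which the image `x̄` of `x_d`
is a regular element generating a reduction of `Ī`. There
`λ(Īⁿ⁺¹/x̄Īⁿ) + λ(Īⁿ/Īⁿ⁺¹) = λ(R̄/x̄R̄)` for all `n` (`quotLength_add_eq_const`), and so
`Δ[P_Ī(n) - H_Ī(n)] = λ(Īⁿ⁺¹/x̄Īⁿ)`, with sum `e₁(Ī)` (`exists_hilbertCoeffs`). Finally the kernel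
of `Iⁿ⁺¹/JIⁿ → Īⁿ⁺¹/x̄Īⁿ` is `(K ∩ Iⁿ⁺¹)/(K ∩ JIⁿ)` (`quotLength_eq_add_map`).
-/

/-! ### Lengths of subquotients -/

/-- The map `M / N → M' / N'` induced by an inclusion `M ≤ M'` with `N ≤ N'`. -/
def subQuotientInclusion {R : Type u} [CommRing R] {M N M' N' : Ideal R} (hM : M ≤ M')
    (hN : N ≤ N') : SubQuotient M N →ₗ[R] SubQuotient M' N' :=
  Submodule.mapQ _ _ (Submodule.inclusion hM) (fun _ hz => hN hz)

theorem subQuotient_mk_eq_zero {R : Type u} [CommRing R] {M N : Ideal R} (z : M) :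
    (Submodule.Quotient.mk z : SubQuotient M N) = 0 ↔ (z : R) ∈ N :=
  Submodule.Quotient.mk_eq_zero _

theorem quotLength_eq_add {R : Type u} [CommRing R] {M N P : Ideal R} (hNM : N ≤ M) (hPN : P ≤ N) :
    quotLength M P = quotLength N P + quotLength M N := by
  refine Module.length_eq_add_of_exact (subQuotientInclusion hNM le_rfl)
    (subQuotientInclusion le_rfl hPN) ?_ ?_ ?_
  · rw [← LinearMap.ker_eq_bot, LinearMap.ker_eq_bot']
    intro z
    induction z using Submodule.Quotient.induction_on with
    | _ z =>
      intro hz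
      exact (subQuotient_mk_eq_zero _).2 ((subQuotient_mk_eq_zero (Submodule.inclusion hNM z)).1 hz)
  · intro z
    induction z using Submodule.Quotient.induction_on with
    | _ z => exact ⟨Submodule.Quotient.mk z, rfl⟩
  · intro z
    induction z using Submodule.Quotient.induction_on with
    | _ z =>
      constructor
      · intro hz
        have hz' : (z : R) ∈ N :=
          (subQuotient_mk_eq_zero (Submodule.inclusion le_rfl z)).1 hz
        exact ⟨Submodule.Quotient.mk ⟨z, hz'⟩, rfl⟩
      · rintro ⟨w, hw⟩
        induction w using Submodule.Quotient.induction_on with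
        | _ w =>
          rw [← hw]
          exact (Submodule.Quotient.mk_eq_zero _).2 w.2

theorem quotLength_self {R : Type u} [CommRing R] (M : Ideal R) : quotLength M M = 0 := by
  rw [quotLength, Module.length_eq_zero_iff]
  refine ⟨fun a b => ?_⟩
  induction a using Submodule.Quotient.induction_on with
  | _ a =>
    induction b using Submodule.Quotient.induction_on with
    | _ b => exact (Submodule.Quotient.eq _).2 (M.sub_mem a.2 b.2)

theorem quotLength_mono_left {R : Type u} [CommRing R] (K : Ideal R) {M N : Ideal R} :
    quotLength (K ⊓ M) (K ⊓ N) ≤ quotLength M N := by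
  refine Module.length_le_of_injective (subQuotientInclusion inf_le_right inf_le_right) ?_
  rw [← LinearMap.ker_eq_bot, LinearMap.ker_eq_bot']
  intro z
  induction z using Submodule.Quotient.induction_on with
  | _ z =>
    intro hz
    exact (subQuotient_mk_eq_zero _).2 ⟨z.2.1,
      (subQuotient_mk_eq_zero (Submodule.inclusion inf_le_right z)).1 hz⟩

/-- A subquotient killed by a power of the maximal ideal has finite length. -/
theorem quotLength_ne_top {R : Type u} [CommRing R] [IsNoetherianRing R] [IsLocalRing R]
    {M N : Ideal R} {s : ℕ} (h : IsLocalRing.maximalIdeal R ^ s * M ≤ N) :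
    quotLength M N ≠ ⊤ := by
  set A := R ⧸ (IsLocalRing.maximalIdeal R ^ s) with hA
  have htor : Module.IsTorsionBySet R (SubQuotient M N)
      ((IsLocalRing.maximalIdeal R ^ s : Ideal R) : Set R) := by
    rintro z ⟨r, hr⟩
    induction z using Submodule.Quotient.induction_on with
    | _ z => exact (Submodule.Quotient.mk_eq_zero _).2 (h (Ideal.mul_mem_mul hr z.2))
  have : IsArtinianRing A := by
    rcases subsingleton_or_nontrivial A with h0 | h0
    · infer_instance
    · have hne : IsLocalRing.maximalIdeal R ^ s ≠ ⊤ := Ideal.Quotient.nontrivial_iff.1 h0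
      have : IsLocalRing A := IsLocalRing.of_surjective' (Ideal.Quotient.mk _)
        Ideal.Quotient.mk_surjective
      rw [isArtinianRing_iff_isNilpotent_maximalIdeal]
      refine ⟨s, ?_⟩
      have hm : IsLocalRing.maximalIdeal A ≤
          (IsLocalRing.maximalIdeal R).map (Ideal.Quotient.mk _) := by
        intro z hz
        obtain ⟨z, rfl⟩ := Ideal.Quotient.mk_surjective z
        refine Ideal.mem_map_of_mem _ ?_
        rw [IsLocalRing.mem_maximalIdeal, mem_nonunits_iff] at hz ⊢
        exact fun hu => hz (hu.map _)
      have h1 := Ideal.pow_right_mono hm s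
      rw [← Ideal.map_pow, Ideal.map_quotient_self] at h1
      exact le_bot_iff.1 h1
  let _ : Module A (SubQuotient M N) := htor.module
  have : IsScalarTower R A (SubQuotient M N) := htor.isScalarTower
  have : Module.Finite A (SubQuotient M N) := Module.Finite.of_restrictScalars_finite R A _
  rw [quotLength, Module.length_eq_of_surjective (S := R) (R := A) (M := SubQuotient M N)
    Ideal.Quotient.mk_surjective]
  exact Module.length_ne_top

/-- The kernel of `M / N → M R̄ / N R̄`, where `R̄ = R / K`, is `(K ∩ M) / (K ∩ N)`. -/
theorem quotLength_eq_add_map {R : Type u} [CommRing R] {M N : Ideal R} (K : Ideal R)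
    (hNM : N ≤ M) :
    quotLength M N = quotLength (K ⊓ M) (K ⊓ N) +
      quotLength (M.map (Ideal.Quotient.mk K)) (N.map (Ideal.Quotient.mk K)) := by
  have hmem : ∀ {L : Ideal R} {y : R ⧸ K}, y ∈ L.map (Ideal.Quotient.mk K) ↔
      ∃ z ∈ L, Ideal.Quotient.mk K z = y := fun {L y} =>
    Ideal.mem_map_iff_of_surjective _ Ideal.Quotient.mk_surjective
  rw [quotLength, quotLength, quotLength, ← Module.length_eq_of_surjective (S := R) (R := R ⧸ K)
    (M := SubQuotient (M.map (Ideal.Quotient.mk K)) (N.map (Ideal.Quotient.mk K)))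
    Ideal.Quotient.mk_surjective]
  let p : M →ₗ[R] (M.map (Ideal.Quotient.mk K)) :=
    { toFun := fun z => ⟨Ideal.Quotient.mk K z, Ideal.mem_map_of_mem _ z.2⟩
      map_add' := fun _ _ => rfl
      map_smul' := fun _ _ => rfl }
  let q : (M.map (Ideal.Quotient.mk K)) →ₗ[R]
      SubQuotient (M.map (Ideal.Quotient.mk K)) (N.map (Ideal.Quotient.mk K)) :=
    (Submodule.mkQ _).restrictScalars R
  let f : SubQuotient M N →ₗ[R]
      SubQuotient (M.map (Ideal.Quotient.mk K)) (N.map (Ideal.Quotient.mk K)) :=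
    Submodule.liftQ _ (q.comp p) (by
      intro z hz
      exact (Submodule.Quotient.mk_eq_zero _).2
        (Ideal.mem_map_of_mem (Ideal.Quotient.mk K) (show (z : R) ∈ N from hz)))
  have hf : ∀ z : M, f (Submodule.Quotient.mk z) = 0 ↔ Ideal.Quotient.mk K (z : R) ∈
      N.map (Ideal.Quotient.mk K) := fun z => Submodule.Quotient.mk_eq_zero _
  refine Module.length_eq_add_of_exact
    (subQuotientInclusion (inf_le_right : K ⊓ M ≤ M) (inf_le_right : K ⊓ N ≤ N)) f ?_ ?_ ?_
  · rw [← LinearMap.ker_eq_bot, LinearMap.ker_eq_bot']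
    intro z
    induction z using Submodule.Quotient.induction_on with
    | _ z =>
      intro hz
      exact (subQuotient_mk_eq_zero _).2 ⟨z.2.1,
      (subQuotient_mk_eq_zero (Submodule.inclusion inf_le_right z)).1 hz⟩
  · intro z
    induction z using Submodule.Quotient.induction_on with
    | _ z =>
      obtain ⟨z, hz⟩ := z
      obtain ⟨w, hw, rfl⟩ := hmem.1 hz
      exact ⟨Submodule.Quotient.mk ⟨w, hw⟩, rfl⟩
  · intro z
    induction z using Submodule.Quotient.induction_on with
    | _ z =>
      rw [hf]
      constructor
      · intro hz
        obtain ⟨w, hw, hwz⟩ := hmem.1 hz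
        have hk : (z : R) - w ∈ K := Ideal.Quotient.eq.1 hwz.symm
        refine ⟨Submodule.Quotient.mk ⟨z - w, hk, M.sub_mem z.2 (hNM hw)⟩, ?_⟩
        refine (Submodule.Quotient.eq _).2 ?_
        change ((z : R) - w) - z ∈ N
        simpa using hw
      · rintro ⟨w, hw⟩
        induction w using Submodule.Quotient.induction_on with
        | _ w =>
          have h1 : (w : R) - z ∈ N := (Submodule.Quotient.eq
            (Submodule.comap M.subtype N) (x := Submodule.inclusion inf_le_right w) (y := z)).1 hw
          have h2 : Ideal.Quotient.mk K (w : R) = 0 := Ideal.Quotient.eq_zero_iff_mem.2 w.2.1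
          have h3 := Ideal.mem_map_of_mem (Ideal.Quotient.mk K) h1
          rw [map_sub, h2, zero_sub] at h3
          exact (Submodule.neg_mem_iff _).1 h3

/-- Multiplication by a nonzerodivisor is an isomorphism `M / N ≃ xM / xN`. -/
theorem quotLength_span_singleton_mul {R : Type u} [CommRing R] {x : R} (hx : x ∈ nonZeroDivisors R)
    {M N : Ideal R} :
    quotLength (Ideal.span {x} * M) (Ideal.span {x} * N) = quotLength M N := by
  let p : M →ₗ[R] (Ideal.span {x} * M : Ideal R) :=
    { toFun := fun z => ⟨x * z, Ideal.mul_mem_mul (Ideal.mem_span_singleton_self x) z.2⟩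
      map_add' := fun _ _ => Subtype.ext (mul_add _ _ _)
      map_smul' := fun _ _ => Subtype.ext (mul_left_comm _ _ _) }
  have hp : ∀ z : M, (p z : R) = x * z := fun _ => rfl
  let f := Submodule.mapQ (Submodule.comap M.subtype N)
    (Submodule.comap (Ideal.span {x} * M : Ideal R).subtype (Ideal.span {x} * N)) p
    (fun z hz => Ideal.mul_mem_mul (Ideal.mem_span_singleton_self x) hz)
  refine (LinearEquiv.length_eq (LinearEquiv.ofBijective f ⟨?_, ?_⟩)).symm
  · rw [← LinearMap.ker_eq_bot, LinearMap.ker_eq_bot']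
    intro z
    induction z using Submodule.Quotient.induction_on with
    | _ z =>
      intro hz
      have hz' : x * (z : R) ∈ Ideal.span {x} * N := (subQuotient_mk_eq_zero (p z)).1 hz
      obtain ⟨w, hw, hwz⟩ := Ideal.mem_span_singleton_mul.1 hz'
      have : w = z := (mul_cancel_left_mem_nonZeroDivisors hx).1 hwz
      exact (subQuotient_mk_eq_zero _).2 (this ▸ hw)
  · intro z
    induction z using Submodule.Quotient.induction_on with
    | _ z =>
      obtain ⟨z, hz⟩ := z
      obtain ⟨w, hw, rfl⟩ := Ideal.mem_span_singleton_mul.1 hz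
      exact ⟨Submodule.Quotient.mk ⟨w, hw⟩, rfl⟩

/-! ### One-dimensional Cohen–Macaulay local rings -/

/-- If `I` contains a power of the maximal ideal, then `Iⁱ/Iⁱ⁺¹` is its own zeroth local
cohomology. -/
theorem length_gammaM_eq_quotLength {A : Type u} [CommRing A] [IsLocalRing A] {I : Ideal A}
    {s : ℕ} (hs : IsLocalRing.maximalIdeal A ^ s ≤ I) (i : ℕ) :
    Module.length A (gammaM A (SubQuotient (I ^ i) (I ^ (i + 1)))) =
      quotLength (I ^ i) (I ^ (i + 1)) := by
  have htop : gammaM A (SubQuotient (I ^ i) (I ^ (i + 1))) = ⊤ := by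
    rw [eq_top_iff]
    intro z _
    refine ⟨s + 1, s.succ_pos, fun r hr => ?_⟩
    induction z using Submodule.Quotient.induction_on with
    | _ z =>
      have hrI : r ∈ I := hs (Ideal.pow_le_pow_right s.le_succ hr)
      refine (subQuotient_mk_eq_zero (r • z)).2 ?_
      rw [pow_succ']
      exact Ideal.mul_mem_mul hrI z.2
  rw [htop, Module.length_top, quotLength]

theorem generalizedHilbertFunction_natCast {A : Type u} [CommRing A] [IsLocalRing A] {I : Ideal A}
    {s : ℕ} (hs : IsLocalRing.maximalIdeal A ^ s ≤ I) (n : ℕ) :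
    generalizedHilbertFunction I n =
      ∑ i ∈ Finset.range (n + 1), (quotLength (I ^ i) (I ^ (i + 1))).toNat := by
  simp only [generalizedHilbertFunction, length_gammaM_eq_quotLength hs]
  congr 1

theorem polynomialOfCoeffs_one_eval (e : ℕ → ℤ) (q : ℚ) :
    (polynomialOfCoeffs 1 e).eval q = e 0 * (q + 1) - e 1 := by
  simp [polynomialOfCoeffs, Finset.sum_range_succ, Polynomial.preHilbertPoly]
  ring

/-- For a regular element `x ∈ I` of a local ring in which `I` is primary to the maximal ideal,
`λ(Iⁿ⁺¹/xIⁿ) + λ(Iⁿ/Iⁿ⁺¹)` does not depend on `n` (it is the multiplicity of `x`): both this sum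
and its successor are obtained by comparing two filtrations of `Iⁿ/xIⁿ⁺¹`. -/
theorem quotLength_add_eq_const {A : Type u} [CommRing A] [IsLocalRing A] [IsNoetherianRing A]
    {I : Ideal A} {x : A} (hxI : x ∈ I) (hx : x ∈ nonZeroDivisors A)
    {s : ℕ} (hs : IsLocalRing.maximalIdeal A ^ s ≤ Ideal.span {x}) (n : ℕ) :
    quotLength (I ^ (n + 1)) (Ideal.span {x} * I ^ n) + quotLength (I ^ n) (I ^ (n + 1)) =
      quotLength ⊤ (Ideal.span {x}) := by
  have hxI' : Ideal.span {x} ≤ I := (Ideal.span_singleton_le_iff_mem I).2 hxI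
  have h1 : ∀ n, Ideal.span {x} * I ^ n ≤ I ^ (n + 1) := fun n => by
    rw [pow_succ']; exact Ideal.mul_mono_left hxI'
  have h2 : ∀ n, I ^ (n + 1) ≤ I ^ n := fun n => Ideal.pow_le_pow_right n.le_succ
  have h0 : ∀ n, quotLength (I ^ (n + 1)) (Ideal.span {x} * I ^ n) +
      quotLength (I ^ n) (I ^ (n + 1)) = quotLength (I ^ n) (Ideal.span {x} * I ^ n) :=
    fun n => (quotLength_eq_add (h2 n) (h1 n)).symm
  rw [h0]
  induction n with
  | zero => simp
  | succ n ih =>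
    rw [← ih]
    have e1 := quotLength_eq_add (h2 n)
      (Ideal.mul_le_right : Ideal.span {x} * I ^ (n + 1) ≤ I ^ (n + 1))
    have e2 := quotLength_eq_add (Ideal.mul_le_right : Ideal.span {x} * I ^ n ≤ I ^ n)
      (Ideal.mul_mono_right (I := Ideal.span {x}) (h2 n))
    rw [quotLength_span_singleton_mul hx] at e2
    have hfin : quotLength (I ^ n) (I ^ (n + 1)) ≠ ⊤ := by
      refine quotLength_ne_top (s := s) ?_
      rw [pow_succ']
      exact Ideal.mul_mono_left (hs.trans hxI')
    rw [e1, add_comm] at e2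
    exact ENat.add_right_injective_of_ne_top hfin e2

/-- The Hilbert coefficients of a one-dimensional Cohen–Macaulay local ring: if the regular element
`x` generates a reduction of the ideal `I` primary to the maximal ideal, then
`Δ[P_I(n) - H_I(n)] = λ(Iⁿ⁺¹/xIⁿ)` and these lengths sum up to `e₁(I)`. -/
theorem exists_hilbertCoeffs {A : Type u} [CommRing A] [IsLocalRing A] [IsNoetherianRing A]
    (hdim : ringKrullDim A = 1) {I : Ideal A} {x : A} (hxI : x ∈ I) (hx : x ∈ nonZeroDivisors A)
    {s N : ℕ} (hs : IsLocalRing.maximalIdeal A ^ s ≤ Ideal.span {x})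
    (hN : ∀ n, N ≤ n → I ^ (n + 1) = Ideal.span {x} * I ^ n) :
    ∃ e : ℕ → ℤ, AreGeneralizedHilbertCoeffs I 1 e ∧
      (∀ n : ℕ, ((quotLength (I ^ (n + 1)) (Ideal.span {x} * I ^ n)).toNat : ℚ) =
        backwardDiff (fun m : ℤ => (polynomialOfCoeffs 1 e).eval (m : ℚ)
          - (generalizedHilbertFunction I m : ℚ)) n) ∧
      HasSum (fun n : ℕ => ((quotLength (I ^ (n + 1)) (Ideal.span {x} * I ^ n)).toNat : ℤ))
        (e 1) := by
  have hxI' : Ideal.span {x} ≤ I := (Ideal.span_singleton_le_iff_mem I).2 hxI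
  have hfin : quotLength ⊤ (Ideal.span {x}) ≠ ⊤ :=
    quotLength_ne_top (s := s) (by rwa [Ideal.mul_top])
  set δ : ℕ → ℕ := fun n => (quotLength (I ^ (n + 1)) (Ideal.span {x} * I ^ n)).toNat with hδ
  set h : ℕ → ℕ := fun n => (quotLength (I ^ n) (I ^ (n + 1))).toNat with hh
  set e0 : ℕ := (quotLength ⊤ (Ideal.span {x})).toNat with he0
  have key : ∀ n, δ n + h n = e0 := by
    intro n
    have := quotLength_add_eq_const hxI hx hs n
    have hne := this ▸ hfin
    rw [he0, ← this, ENat.toNat_add (fun h => hne (by rw [h, top_add]))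
      (fun h => hne (by rw [h, add_top]))]
  have hδ0 : ∀ n, N ≤ n → δ n = 0 := by
    intro n hn
    simp only [hδ]
    rw [hN n hn, quotLength_self]
    rfl
  have hH := generalizedHilbertFunction_natCast (hs.trans hxI')
  have hsum : ∀ n : ℕ, (∑ i ∈ Finset.range n, (h i : ℤ)) =
      e0 * n - ∑ i ∈ Finset.range n, (δ i : ℤ) := by
    intro n
    induction n with
    | zero => simp
    | succ n ih =>
      rw [Finset.sum_range_succ, Finset.sum_range_succ, ih]
      have : (δ n : ℤ) + h n = e0 := by exact_mod_cast key n
      push_cast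
      linarith
  have hconst : ∀ n, N ≤ n → (∑ i ∈ Finset.range n, (δ i : ℤ)) =
      ∑ i ∈ Finset.range N, (δ i : ℤ) := by
    intro n hn
    refine (Finset.sum_subset (Finset.range_mono hn) fun i _ hi => ?_).symm
    rw [hδ0 i (by simpa using hi), Nat.cast_zero]
  refine ⟨fun i => if i = 0 then e0 else ∑ i ∈ Finset.range N, (δ i : ℤ), ⟨?_, ?_⟩, ?_, ?_⟩
  · simpa using hdim
  · filter_upwards [Filter.eventually_ge_atTop N] with n hn
    rw [polynomialOfCoeffs_one_eval, hH]
    have := hsum (n + 1)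
    rw [hconst (n + 1) (by omega)] at this
    simp only [if_true, one_ne_zero, if_false]
    exact_mod_cast this
  · intro n
    have hk : (δ n : ℚ) + h n = e0 := by exact_mod_cast key n
    have hd : (generalizedHilbertFunction I (n : ℤ) : ℚ) -
        generalizedHilbertFunction I ((n : ℤ) - 1) = h n := by
      cases n with
      | zero =>
        rw [hH]
        simp [generalizedHilbertFunction, hh]
      | succ n =>
        have : ((n + 1 : ℕ) : ℤ) - 1 = (n : ℕ) := by push_cast; ring
        rw [this, hH, hH, Finset.sum_range_succ _ (n + 1)]
        simp [hh]
    simp only [backwardDiff, polynomialOfCoeffs_one_eval, if_true]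
    push_cast
    linarith
  · simp only [one_ne_zero, if_false]
    exact hasSum_sum_of_ne_finset_zero fun n hn => by
      rw [← Nat.cast_zero, Nat.cast_inj]
      exact hδ0 n (by simpa using hn)

/-! ### The residual intersection `K = J_{d-1} : I^∞` -/

theorem le_colonPowers {R : Type u} [CommRing R] (J I : Ideal R) : J ≤ colonPowers J I :=
  fun _ ha => ⟨1, one_pos, fun b _ => J.mul_mem_right b ha⟩

theorem exists_colonPowers_mul_pow_le {R : Type u} [CommRing R] [IsNoetherianRing R]
    (J I : Ideal R) : ∃ t, colonPowers J I * I ^ t ≤ J := by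
  obtain ⟨S, hS⟩ := (IsNoetherian.noetherian (colonPowers J I) : (colonPowers J I).FG)
  have key : ∀ T : Finset R, (T : Set R) ⊆ colonPowers J I →
      ∃ t, Ideal.span (T : Set R) * I ^ t ≤ J := by
    classical
    intro T
    induction T using Finset.induction_on with
    | empty => intro _; exact ⟨0, by simp⟩
    | insert a T _ ih =>
      intro hT
      rw [Finset.coe_insert, Set.insert_subset_iff] at hT
      obtain ⟨t, ht⟩ := ih hT.2
      obtain ⟨t', -, ht'⟩ := hT.1
      refine ⟨t + t', ?_⟩
      rw [Finset.coe_insert, Ideal.span_insert, Ideal.sup_mul, sup_le_iff]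
      refine ⟨?_, (Ideal.mul_mono_right (Ideal.pow_le_pow_right (by omega))).trans ht⟩
      rw [Ideal.span_singleton_mul_le_iff]
      exact fun b hb => ht' b (Ideal.pow_le_pow_right (by omega) hb)
  obtain ⟨t, ht⟩ := key S (hS ▸ Submodule.subset_span)
  exact ⟨t, hS ▸ ht⟩

/-- `I` has positive grade on `R / (J : I^∞)`. -/
theorem mem_colonPowers_of_mul_pow_le {R : Type u} [CommRing R] [IsNoetherianRing R]
    {J I : Ideal R} {a : R} {t : ℕ} (h : ∀ b ∈ I ^ t, a * b ∈ colonPowers J I) :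
    a ∈ colonPowers J I := by
  obtain ⟨t', ht'⟩ := exists_colonPowers_mul_pow_le J I
  refine ⟨t + t' + 1, by omega, fun b hb => ?_⟩
  have hb' : b ∈ I ^ t * I ^ t' := by
    rw [← pow_add]
    exact Ideal.pow_le_pow_right (by omega) hb
  refine Submodule.mul_induction_on hb' (fun u hu v hv => ?_) (fun u v hu hv => ?_)
  · rw [← mul_assoc]
    exact ht' (Ideal.mul_mem_mul (h u hu) hv)
  · rw [mul_add]
    exact J.add_mem hu hv

theorem sup_pow_le_pow_sup {R : Type u} [CommRing R] (I C : Ideal R) (k : ℕ) :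
    (I ⊔ C) ^ k ≤ I ^ k ⊔ C := by
  induction k with
  | zero => simp
  | succ k ih =>
    rw [pow_succ, pow_succ]
    refine (Ideal.mul_mono_left ih).trans ?_
    rw [Ideal.sup_mul, Ideal.mul_sup, sup_le_iff, sup_le_iff]
    exact ⟨⟨le_sup_left, Ideal.mul_le_right.trans le_sup_right⟩,
      Ideal.mul_le_left.trans le_sup_right⟩

theorem pow_succ_eq_mul_pow_of_le {R : Type u} [CommRing R] {I J : Ideal R} {N : ℕ}
    (h : I ^ (N + 1) = J * I ^ N) {n : ℕ} (hn : N ≤ n) : I ^ (n + 1) = J * I ^ n := by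
  obtain ⟨k, rfl⟩ := Nat.exists_eq_add_of_le hn
  rw [show N + k + 1 = N + 1 + k by ring, pow_add, h, mul_assoc, ← pow_add]

theorem initialIdeal_le_fullIdeal {R : Type u} [CommRing R] {d : ℕ} (x : Fin d → R) (i : ℕ) :
    initialIdeal x i ≤ fullIdeal x := by
  refine Ideal.span_mono ?_
  rintro _ ⟨j, -, rfl⟩
  exact ⟨j, rfl⟩

/-- Modulo `K`, the ideal `J` is generated by the image of `x_d`. -/
theorem map_mk_fullIdeal {R : Type u} [CommRing R] (I : Ideal R) {n : ℕ} (x : Fin (n + 1) → R) :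
    (fullIdeal x).map (Ideal.Quotient.mk (residualIdeal I x)) =
      Ideal.span {Ideal.Quotient.mk (residualIdeal I x) (x (Fin.last n))} := by
  rw [Ideal.map_span]
  refine le_antisymm (Ideal.span_le.2 ?_) (Ideal.span_mono ?_)
  · rintro _ ⟨_, ⟨i, rfl⟩, rfl⟩
    induction i using Fin.lastCases with
    | last => exact Ideal.mem_span_singleton_self _
    | cast i =>
      have : Ideal.Quotient.mk (residualIdeal I x) (x i.castSucc) = 0 := by
        rw [Ideal.Quotient.eq_zero_iff_mem]
        exact le_colonPowers _ _ (Ideal.subset_span ⟨i.castSucc, by simp, rfl⟩)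
      rw [this]
      exact Submodule.zero_mem _
  · rintro _ rfl
    exact ⟨_, ⟨_, rfl⟩, rfl⟩

/-- The lengths `λ(Iⁿ⁺¹/JIⁿ)` are finite as soon as `J` is a reduction of `I` which agrees with
`I` on the punctured spectrum. -/
theorem quotLength_pow_succ_ne_top {R : Type u} [CommRing R] [IsNoetherianRing R] [IsLocalRing R]
    {I J C : Ideal R} {s N : ℕ} (hs : IsLocalRing.maximalIdeal R ^ s ≤ I ⊔ C) (hC : C * I ≤ J)
    (hred : I ^ (N + 1) = J * I ^ N) (n : ℕ) : quotLength (I ^ (n + 1)) (J * I ^ n) ≠ ⊤ := by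
  refine quotLength_ne_top (s := s * (N + 1)) ?_
  rw [pow_mul]
  refine (Ideal.mul_mono_left ((Ideal.pow_right_mono hs _).trans
    (sup_pow_le_pow_sup _ _ _))).trans ?_
  rw [Ideal.sup_mul, sup_le_iff]
  constructor
  · rw [hred, mul_assoc, ← pow_add]
    exact Ideal.mul_mono_right (Ideal.pow_le_pow_right (by omega))
  · rw [pow_succ', ← mul_assoc]
    exact Ideal.mul_mono_left hC

/-- The conclusion for a fixed sequence `x`, from the three properties that general elements have:
`J` is a reduction of `I`, it agrees with `I` on the punctured spectrum already without `x_d`, and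
`K ≠ R`. -/
theorem hilbertCoeffs_of_reduction {R : Type u} [CommRing R] [IsNoetherianRing R] [IsLocalRing R]
    {n : ℕ} {I : Ideal R} {x : Fin (n + 1) → R} (hIm : I ≤ IsLocalRing.maximalIdeal R)
    (hxI : ∀ i, x i ∈ I) (hK : residualIdeal I x ≠ ⊤) {C : Ideal R} {s N : ℕ}
    (hs : IsLocalRing.maximalIdeal R ^ s ≤ I ⊔ C) (hC : C * I ≤ initialIdeal x n)
    (hred : I ^ (N + 1) = fullIdeal x * I ^ N) :
    ∃ (_ : IsLocalRing (R ⧸ residualIdeal I x)) (e : ℕ → ℤ),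
        (imageIdeal I x).radical = IsLocalRing.maximalIdeal (R ⧸ residualIdeal I x) ∧
        AreGeneralizedHilbertCoeffs (imageIdeal I x) 1 e ∧
        (∀ n : ℕ, quotLength (I ^ (n + 1)) (fullIdeal x * I ^ n) ≠ ⊤ ∧
          quotLength (residualIdeal I x ⊓ I ^ (n + 1))
            (residualIdeal I x ⊓ (fullIdeal x * I ^ n)) ≠ ⊤) ∧
        (∀ n : ℕ,
          ((quotLength (I ^ (n + 1)) (fullIdeal x * I ^ n)).toNat : ℚ)
              - ((quotLength (residualIdeal I x ⊓ I ^ (n + 1))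
                  (residualIdeal I x ⊓ (fullIdeal x * I ^ n))).toNat : ℚ) =
            backwardDiff (fun m : ℤ => (polynomialOfCoeffs 1 e).eval (m : ℚ)
              - (generalizedHilbertFunction (imageIdeal I x) m : ℚ)) n) ∧
        HasSum (fun n : ℕ =>
          ((quotLength (I ^ (n + 1)) (fullIdeal x * I ^ n)).toNat : ℤ)
            - ((quotLength (residualIdeal I x ⊓ I ^ (n + 1))
                (residualIdeal I x ⊓ (fullIdeal x * I ^ n))).toNat : ℤ)) (e 1) := by
  set K := residualIdeal I x with hKdef
  have hnt : Nontrivial (R ⧸ K) := Ideal.Quotient.nontrivial_iff.2 hK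
  have hloc : IsLocalRing (R ⧸ K) :=
    IsLocalRing.of_surjective' (Ideal.Quotient.mk _) Ideal.Quotient.mk_surjective
  have hlh : IsLocalHom (Ideal.Quotient.mk K) :=
    IsLocalHom.of_surjective _ Ideal.Quotient.mk_surjective
  set π := Ideal.Quotient.mk K with hπ
  set xb := π (x (Fin.last n)) with hxb
  have hmb : (IsLocalRing.maximalIdeal R).map π = IsLocalRing.maximalIdeal (R ⧸ K) := by
    refine le_antisymm (Ideal.map_le_iff_le_comap.2 fun z hz => ?_) fun z hz => ?_
    · rw [Ideal.mem_comap, IsLocalRing.mem_maximalIdeal, mem_nonunits_iff]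
      rw [IsLocalRing.mem_maximalIdeal, mem_nonunits_iff] at hz
      exact fun hu => hz (isUnit_of_map_unit π z hu)
    · obtain ⟨z, rfl⟩ := Ideal.Quotient.mk_surjective z
      refine Ideal.mem_map_of_mem _ ?_
      rw [IsLocalRing.mem_maximalIdeal, mem_nonunits_iff] at hz ⊢
      exact fun hu => hz (hu.map _)
  have hIb : imageIdeal I x ≤ IsLocalRing.maximalIdeal (R ⧸ K) := hmb ▸ Ideal.map_mono hIm
  have hxb_mem : xb ∈ imageIdeal I x := Ideal.mem_map_of_mem _ (hxI _)
  have hCK : C ≤ K := fun c hc => ⟨1, one_pos, fun b hb =>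
    hC (Ideal.mul_mem_mul hc (by simpa using hb))⟩
  have hsb : IsLocalRing.maximalIdeal (R ⧸ K) ^ s ≤ imageIdeal I x := by
    rw [← hmb, ← Ideal.map_pow]
    refine (Ideal.map_mono hs).trans ?_
    rw [Ideal.map_sup, sup_le_iff]
    refine ⟨le_rfl, (Ideal.map_mono hCK).trans ?_⟩
    rw [hπ, Ideal.map_quotient_self]
    exact bot_le
  have hredb : imageIdeal I x ^ (N + 1) = Ideal.span {xb} * imageIdeal I x ^ N := by
    have := congrArg (Ideal.map π) hred
    rwa [Ideal.map_mul, Ideal.map_pow, Ideal.map_pow, map_mk_fullIdeal] at this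
  have hsx : IsLocalRing.maximalIdeal (R ⧸ K) ^ (s * (N + 1)) ≤ Ideal.span {xb} := by
    rw [pow_mul]
    exact (Ideal.pow_right_mono hsb _).trans (hredb.le.trans Ideal.mul_le_left)
  have hreg : xb ∈ nonZeroDivisors (R ⧸ K) := by
    rw [mem_nonZeroDivisors_iff_right]
    intro z hz
    obtain ⟨z, rfl⟩ := Ideal.Quotient.mk_surjective z
    rw [Ideal.Quotient.eq_zero_iff_mem]
    refine mem_colonPowers_of_mul_pow_le (t := N + 1) fun b hb => ?_
    have hb' : π b ∈ Ideal.span {xb} * imageIdeal I x ^ N := by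
      rw [← hredb, ← Ideal.map_pow]
      exact Ideal.mem_map_of_mem _ hb
    obtain ⟨w, -, hw⟩ := Ideal.mem_span_singleton_mul.1 hb'
    rw [← Ideal.Quotient.eq_zero_iff_mem, map_mul]
    change π z * π b = 0
    rw [← hw, ← mul_assoc]
    change π z * xb = 0 at hz
    rw [hz, zero_mul]
  have hxm : Ideal.span {xb} ≤ IsLocalRing.maximalIdeal (R ⧸ K) :=
    (Ideal.span_singleton_le_iff_mem _).2 (hIb hxb_mem)
  have hdim : ringKrullDim (R ⧸ K) = 1 := by
    rw [← IsLocalRing.maximalIdeal_height_eq_ringKrullDim]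
    refine congrArg _ (le_antisymm ?_ ?_)
    · refine Ideal.height_le_one_of_isPrincipal_of_mem_minimalPrimes (Ideal.span {xb}) _
        ⟨⟨inferInstance, hxm⟩, fun q hq _ => ?_⟩
      have := hq.1
      exact Ideal.IsPrime.le_of_pow_le (hsx.trans hq.2)
    · exact (Ideal.one_le_height_span_singleton_of_mem_nonZeroDivisors hreg).trans
        (Ideal.height_mono hxm)
  obtain ⟨e, he1, he2, he3⟩ := exists_hilbertCoeffs hdim hxb_mem hreg hsx
    (fun k hk => pow_succ_eq_mul_pow_of_le hredb hk)
  have hfin := quotLength_pow_succ_ne_top hs (hC.trans (initialIdeal_le_fullIdeal x n)) hred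
  have hfinK : ∀ k, quotLength (K ⊓ I ^ (k + 1)) (K ⊓ (fullIdeal x * I ^ k)) ≠ ⊤ := fun k h =>
    hfin k (top_le_iff.1 (h ▸ quotLength_mono_left K))
  have hJI : fullIdeal x ≤ I := Ideal.span_le.2 (by rintro _ ⟨i, rfl⟩; exact hxI i)
  have hdiff : ∀ k, (quotLength (I ^ (k + 1)) (fullIdeal x * I ^ k)).toNat =
      (quotLength (K ⊓ I ^ (k + 1)) (K ⊓ (fullIdeal x * I ^ k))).toNat +
      (quotLength (imageIdeal I x ^ (k + 1)) (Ideal.span {xb} * imageIdeal I x ^ k)).toNat := by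
    intro k
    have hle : fullIdeal x * I ^ k ≤ I ^ (k + 1) := by
      rw [pow_succ']
      exact Ideal.mul_mono_left hJI
    have h := quotLength_eq_add_map K hle
    rw [Ideal.map_mul, Ideal.map_pow, Ideal.map_pow, map_mk_fullIdeal] at h
    have hne := hfin k
    rw [h] at hne ⊢
    exact ENat.toNat_add (hfinK k) (fun h' => hne (by rw [h', add_top]))
  refine ⟨hloc, e, ?_, he1, fun k => ⟨hfin k, hfinK k⟩, fun k => ?_, ?_⟩
  · refine le_antisymm ((Ideal.IsPrime.radical_le_iff inferInstance).2 hIb) ?_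
    exact fun z hz => ⟨s, hsb (Ideal.pow_mem_pow hz s)⟩
  · rw [← he2 k, hdiff]
    push_cast
    ring
  · convert he3 using 2 with k
    rw [hdiff]
    push_cast
    ring

/-! ### The Rees algebra and the special fiber ring -/

theorem MvPolynomial.isPrime_map_C {A σ : Type*} [CommRing A] (P : Ideal A) [P.IsPrime] :
    (P.map (MvPolynomial.C : A →+* MvPolynomial σ A)).IsPrime := by
  rw [← P.mk_ker, ← MvPolynomial.ker_map]
  exact RingHom.ker_isPrime _

/-- The embedding `b ↦ b tᵏ` of `Iᵏ` into the Rees algebra `R[It]` as its component of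
degree `k`. -/
noncomputable def reesMonomial {R : Type u} [CommRing R] (I : Ideal R) (k : ℕ) :
    ↥(I ^ k) →ₗ[R] reesAlgebra I where
  toFun b := ⟨Polynomial.monomial k (b : R), reesAlgebra.monomial_mem.2 b.2⟩
  map_add' _ _ := Subtype.ext (map_add _ _ _)
  map_smul' _ _ := Subtype.ext (map_smul _ _ _)

theorem coe_reesMonomial {R : Type u} [CommRing R] (I : Ideal R) (k : ℕ) (b : ↥(I ^ k)) :
    (reesMonomial I k b : Polynomial R) = Polynomial.monomial k (b : R) := rfl

theorem reesMonomial_mul {R : Type u} [CommRing R] (I : Ideal R) {k l : ℕ} {a b : R}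
    (ha : a ∈ I ^ k) (hb : b ∈ I ^ l) (hab : a * b ∈ I ^ (k + l)) :
    reesMonomial I (k + l) ⟨a * b, hab⟩ = reesMonomial I k ⟨a, ha⟩ * reesMonomial I l ⟨b, hb⟩ :=
  Subtype.ext (Polynomial.monomial_mul_monomial k l a b).symm

/-- The element `a t` of degree one of the Rees algebra. -/
noncomputable def reesLinear {R : Type u} [CommRing R] (I : Ideal R) : I →ₗ[R] reesAlgebra I :=
  (reesMonomial I 1).comp (LinearEquiv.ofEq I (I ^ 1) (pow_one I).symm).toLinearMap

theorem coe_reesLinear {R : Type u} [CommRing R] (I : Ideal R) (a : I) :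
    (reesLinear I a : Polynomial R) = Polynomial.monomial 1 (a : R) := rfl

theorem eq_sum_reesMonomial {R : Type u} [CommRing R] (I : Ideal R) (z : reesAlgebra I) :
    z = ∑ k ∈ (z : Polynomial R).support, reesMonomial I k ⟨(z : Polynomial R).coeff k, z.2 k⟩ := by
  apply Subtype.ext
  rw [AddSubmonoidClass.coe_finsetSum]
  simp only [coe_reesMonomial]
  exact Polynomial.as_sum_support _

/-- The projection of the Rees algebra onto the associated graded ring. -/
noncomputable def gradedMap {R : Type u} [CommRing R] (I : Ideal R) :
    reesAlgebra I →+* AssociatedGradedRing I :=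
  Ideal.Quotient.mk (I.map (algebraMap R (reesAlgebra I)))

theorem gradedMap_surjective {R : Type u} [CommRing R] (I : Ideal R) :
    Function.Surjective (gradedMap I) :=
  Ideal.Quotient.mk_surjective

theorem ker_gradedMap {R : Type u} [CommRing R] (I : Ideal R) :
    RingHom.ker (gradedMap I) = I.map (algebraMap R (reesAlgebra I)) :=
  Ideal.mk_ker

/-- The projection of the Rees algebra onto the special fiber ring. -/
noncomputable def fiberMap {R : Type u} [CommRing R] [IsLocalRing R] (I : Ideal R) :
    reesAlgebra I →+* SpecialFiberRing I :=
  (Ideal.Quotient.mk ((IsLocalRing.maximalIdeal R).map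
    (algebraMap R (AssociatedGradedRing I)))).comp (gradedMap I)

theorem fiberMap_surjective {R : Type u} [CommRing R] [IsLocalRing R] (I : Ideal R) :
    Function.Surjective (fiberMap I) :=
  Ideal.Quotient.mk_surjective.comp (gradedMap_surjective I)

theorem ker_fiberMap {R : Type u} [CommRing R] [IsLocalRing R] {I : Ideal R}
    (hI : I ≤ IsLocalRing.maximalIdeal R) :
    RingHom.ker (fiberMap I) =
      (IsLocalRing.maximalIdeal R).map (algebraMap R (reesAlgebra I)) := by
  have h : (IsLocalRing.maximalIdeal R).map (algebraMap R (AssociatedGradedRing I)) =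
      ((IsLocalRing.maximalIdeal R).map (algebraMap R (reesAlgebra I))).map (gradedMap I) := by
    rw [Ideal.map_map]
    rfl
  rw [fiberMap, ← RingHom.comap_ker, Ideal.mk_ker, h,
    Ideal.comap_map_of_surjective _ (gradedMap_surjective I), ← RingHom.ker_eq_comap_bot,
    ker_gradedMap, sup_eq_left]
  exact Ideal.map_mono hI

/-- The structure map of the special fiber ring as an algebra over the residue field. -/
noncomputable def fiberScalar {R : Type u} [CommRing R] [IsLocalRing R] (I : Ideal R) :
    IsLocalRing.ResidueField R →+* SpecialFiberRing I :=
  Ideal.Quotient.lift (IsLocalRing.maximalIdeal R)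
    ((fiberMap I).comp (algebraMap R (reesAlgebra I))) fun _ hc =>
      Ideal.Quotient.eq_zero_iff_mem.2 (Ideal.mem_map_of_mem (algebraMap R _) hc)

theorem fiberScalar_residue {R : Type u} [CommRing R] [IsLocalRing R] (I : Ideal R) (c : R) :
    fiberScalar I (IsLocalRing.residue R c) = fiberMap I (algebraMap R (reesAlgebra I) c) := rfl

/-- The homomorphism `R[T₁, …, T_r] → R[It]` sending `Tᵢ` to `xᵢ t`. -/
noncomputable def polyToRees {R : Type u} [CommRing R] (I : Ideal R) {r : ℕ} (x : Fin r → I) :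
    MvPolynomial (Fin r) R →ₐ[R] reesAlgebra I :=
  MvPolynomial.aeval fun i => reesLinear I (x i)

/-- If `(x₁, …, x_r)` is a reduction of `I`, then the Rees algebra is a finite module over
`R[T₁, …, T_r]`: it is generated by the components of degree at most the reduction number. -/
theorem polyToRees_finite {R : Type u} [CommRing R] [IsNoetherianRing R] {I : Ideal R} {r N : ℕ}
    (x : Fin r → I) (hred : I ^ (N + 1) = Ideal.span (Set.range fun i => (x i : R)) * I ^ N) :
    (polyToRees I x).Finite := by
  let _ : Algebra (MvPolynomial (Fin r) R) (reesAlgebra I) := (polyToRees I x).toAlgebra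
  have hsm : ∀ (p : MvPolynomial (Fin r) R) (z : reesAlgebra I), p • z = polyToRees I x p * z :=
    fun _ _ => rfl
  have hfg : ∀ k, ∃ S : Finset (I ^ k : Ideal R),
      Submodule.span R (S : Set (I ^ k : Ideal R)) = ⊤ :=
    fun k => (IsNoetherian.noetherian (⊤ : Submodule R (I ^ k : Ideal R)))
  choose S hS using hfg
  let G : Set (reesAlgebra I) := ⋃ k ∈ Finset.range (N + 1), reesMonomial I k '' (S k)
  have hG : G.Finite := (Finset.range (N + 1)).finite_toSet.biUnion
    fun k _ => (S k).finite_toSet.image _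
  let W : Submodule (MvPolynomial (Fin r) R) (reesAlgebra I) := Submodule.span _ G
  have hWs : ∀ (c : R) (z : reesAlgebra I), z ∈ W → c • z ∈ W := by
    intro c z hz
    have : c • z = (MvPolynomial.C c : MvPolynomial (Fin r) R) • z := by
      rw [hsm, Algebra.smul_def]
      congr 1
      exact ((polyToRees I x).commutes c).symm
    rw [this]
    exact W.smul_mem _ hz
  have hlow : ∀ k, k ≤ N → ∀ b : (I ^ k : Ideal R), reesMonomial I k b ∈ W := by
    intro k hk b
    have hb : b ∈ Submodule.span R (S k : Set (I ^ k : Ideal R)) := by rw [hS]; trivial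
    induction hb using Submodule.span_induction with
    | mem b hb =>
      exact Submodule.subset_span (Set.mem_biUnion
        (Finset.mem_coe.2 (Finset.mem_range.2 (by omega)))
        ⟨b, hb, rfl⟩)
    | zero => rw [map_zero]; exact W.zero_mem
    | add b c _ _ hb hc => rw [map_add]; exact W.add_mem hb hc
    | smul c b _ hb => rw [map_smul]; exact hWs c _ hb
  have hall : ∀ k, ∀ b : (I ^ k : Ideal R), reesMonomial I k b ∈ W := by
    intro k
    induction k with
    | zero => exact hlow 0 (Nat.zero_le _)
    | succ k ih =>
      rcases Nat.lt_or_ge N (k + 1) with hk | hk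
      · have hI := pow_succ_eq_mul_pow_of_le hred (Nat.lt_succ_iff.1 hk)
        rintro ⟨b, hb⟩
        suffices h : ∀ b ∈ Ideal.span (Set.range fun i => (x i : R)) * I ^ k,
            ∃ hb : b ∈ I ^ (k + 1), reesMonomial I (k + 1) ⟨b, hb⟩ ∈ W from
          (h b (hI ▸ hb)).2
        intro b hb
        refine Submodule.mul_induction_on hb (fun u hu v hv => ?_) ?_
        · have huI : ∀ c ∈ Ideal.span (Set.range fun i => (x i : R)), c * v ∈ I ^ (k + 1) :=
            fun c hc => hI ▸ Ideal.mul_mem_mul hc hv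
          refine ⟨huI u hu, ?_⟩
          induction hu using Submodule.span_induction with
          | mem u hu =>
            obtain ⟨i, rfl⟩ := hu
            have h1 : reesMonomial I (k + 1) ⟨x i * v, huI _ (Submodule.subset_span ⟨i, rfl⟩)⟩ =
                (MvPolynomial.X i : MvPolynomial (Fin r) R) • reesMonomial I k ⟨v, hv⟩ := by
              rw [hsm, polyToRees, MvPolynomial.aeval_X]
              apply Subtype.ext
              rw [MulMemClass.coe_mul, coe_reesLinear, coe_reesMonomial, coe_reesMonomial,
                Polynomial.monomial_mul_monomial, add_comm 1 k]
            rw [h1]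
            exact W.smul_mem _ (ih _)
          | zero =>
            have : (⟨0 * v, huI 0 (Submodule.zero_mem _)⟩ : (I ^ (k + 1) : Ideal R)) = 0 :=
              Subtype.ext (zero_mul v)
            rw [this, map_zero]
            exact W.zero_mem
          | add a b ha hb iha ihb =>
            have : (⟨(a + b) * v, huI _ (Submodule.add_mem _ ha hb)⟩ : (I ^ (k + 1) : Ideal R)) =
                ⟨a * v, huI a ha⟩ + ⟨b * v, huI b hb⟩ := Subtype.ext (add_mul a b v)
            rw [this, map_add]
            exact W.add_mem iha ihb
          | smul c a ha iha =>
            have : (⟨(c • a) * v, huI _ (Submodule.smul_mem _ c ha)⟩ : (I ^ (k + 1) : Ideal R)) =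
                c • ⟨a * v, huI a ha⟩ := Subtype.ext (mul_assoc c a v)
            rw [this, map_smul]
            exact hWs _ _ iha
        · rintro a b ⟨ha, ha'⟩ ⟨hb, hb'⟩
          exact ⟨Ideal.add_mem _ ha hb, (map_add (reesMonomial I (k + 1)) ⟨a, ha⟩ ⟨b, hb⟩).symm ▸
            W.add_mem ha' hb'⟩
      · exact hlow _ hk
  have htop : W = ⊤ := by
    rw [eq_top_iff]
    intro z _
    rw [eq_sum_reesMonomial I z]
    exact Submodule.sum_mem _ fun k _ => hall k _
  exact ⟨⟨hG.toFinset, by rw [Set.Finite.coe_toFinset]; exact htop⟩⟩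

/-! ### The residual intersection is proper -/

/-- An integral homomorphism from a domain to a ring of the same finite dimension has a prime
lying over zero: a chain of maximal length contracts to a chain of maximal length. -/
theorem exists_isPrime_comap_eq_bot {A B : Type*} [CommRing A] [IsDomain A] [CommRing B]
    (ψ : A →+* B) (hψ : ψ.IsIntegral) {d : ℕ} (hA : ringKrullDim A = d) (hB : ringKrullDim B = d) :
    ∃ p : Ideal B, p.IsPrime ∧ p.comap ψ = ⊥ := by
  let _ : Algebra A B := ψ.toAlgebra
  have : Algebra.IsIntegral A B := ⟨hψ⟩
  obtain ⟨l, hl⟩ := Order.le_krullDim_iff.1 hB.ge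
  have hmono : StrictMono (PrimeSpectrum.comap ψ) := fun p q hpq =>
    Ideal.IsIntegral.comap_lt_comap (R := A) (I := p.asIdeal) (J := q.asIdeal) hpq
  refine ⟨l.head.asIdeal, l.head.isPrime, ?_⟩
  by_contra hne
  let l' := l.map _ hmono
  have hlt : (⊥ : PrimeSpectrum A) < l'.head := by
    refine bot_lt_iff_ne_bot.2 fun h => hne ?_
    exact congrArg PrimeSpectrum.asIdeal h
  have := Order.LTSeries.length_le_krullDim (l'.cons ⊥ hlt)
  have hA' : Order.krullDim (PrimeSpectrum A) = d := hA
  rw [hA', RelSeries.cons_length] at this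
  have h2 : l'.length = d := hl
  rw [h2] at this
  exact absurd (by exact_mod_cast this) (Nat.not_succ_le_self d)

/-- The `R`-endomorphism of `R[T₁, …, T_r]` that sends the first `j` variables to zero. -/
noncomputable def killVars (R : Type u) [CommRing R] (r j : ℕ) :
    MvPolynomial (Fin r) R →ₐ[R] MvPolynomial (Fin r) R :=
  MvPolynomial.aeval fun i => if (i : ℕ) < j then 0 else MvPolynomial.X i

/-- The ideal `(P, T₁, …, T_j)` of `R[T₁, …, T_r]`. -/
noncomputable def coordinateIdeal {R : Type u} [CommRing R] (P : Ideal R) (r j : ℕ) :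
    Ideal (MvPolynomial (Fin r) R) :=
  (P.map MvPolynomial.C).comap (killVars R r j)

instance coordinateIdeal_isPrime {R : Type u} [CommRing R] (P : Ideal R) [P.IsPrime] (r j : ℕ) :
    (coordinateIdeal P r j).IsPrime := by
  have := MvPolynomial.isPrime_map_C (σ := Fin r) P
  exact Ideal.comap_isPrime _ _

theorem coordinateIdeal_zero {R : Type u} [CommRing R] (P : Ideal R) (r : ℕ) :
    coordinateIdeal P r 0 = P.map MvPolynomial.C := by
  have : killVars R r 0 = AlgHom.id R _ := MvPolynomial.algHom_ext fun i => by simp [killVars]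
  rw [coordinateIdeal, this]
  rfl

theorem coordinateIdeal_le {R : Type u} [CommRing R] (P : Ideal R) {r j : ℕ}
    {Q : Ideal (MvPolynomial (Fin r) R)} (hP : P.map MvPolynomial.C ≤ Q)
    (hX : ∀ i : Fin r, (i : ℕ) < j → MvPolynomial.X i ∈ Q) : coordinateIdeal P r j ≤ Q := by
  intro f hf
  -- modulo `Q`, killing the first `j` variables does not change a polynomial
  have h : (Ideal.Quotient.mkₐ R Q).comp (killVars R r j) = Ideal.Quotient.mkₐ R Q := by
    refine MvPolynomial.algHom_ext fun i => ?_
    by_cases hi : (i : ℕ) < j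
    · simp only [killVars, AlgHom.comp_apply, MvPolynomial.aeval_X, if_pos hi, map_zero]
      exact (Ideal.Quotient.eq_zero_iff_mem.2 (hX i hi)).symm
    · simp only [killVars, AlgHom.comp_apply, MvPolynomial.aeval_X, if_neg hi]
  have h1 : Ideal.Quotient.mk Q (killVars R r j f) = Ideal.Quotient.mk Q f := DFunLike.congr_fun h f
  rw [← Ideal.Quotient.eq_zero_iff_mem, ← h1, Ideal.Quotient.eq_zero_iff_mem]
  exact hP hf

theorem map_C_le_coordinateIdeal {R : Type u} [CommRing R] (P : Ideal R) (r j : ℕ) :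
    P.map MvPolynomial.C ≤ coordinateIdeal P r j := by
  rw [Ideal.map_le_iff_le_comap]
  intro c hc
  rw [Ideal.mem_comap, coordinateIdeal, Ideal.mem_comap, MvPolynomial.algHom_C]
  exact Ideal.mem_map_of_mem _ hc

theorem X_mem_coordinateIdeal_iff {R : Type u} [CommRing R] {P : Ideal R} (hP : P ≠ ⊤) {r j : ℕ}
    (i : Fin r) : MvPolynomial.X i ∈ coordinateIdeal P r j ↔ (i : ℕ) < j := by
  rw [coordinateIdeal, Ideal.mem_comap, killVars, MvPolynomial.aeval_X]
  split_ifs with h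
  · simp [h]
  · simp only [h, iff_false]
    intro hm
    have := MvPolynomial.mem_map_C_iff.1 hm (Finsupp.single i 1)
    rw [MvPolynomial.coeff_X, if_pos rfl] at this
    exact hP ((Ideal.eq_top_iff_one _).2 this)

theorem coordinateIdeal_mono {R : Type u} [CommRing R] {P : Ideal R} (hP : P ≠ ⊤) {r i j : ℕ}
    (hij : i ≤ j) : coordinateIdeal P r i ≤ coordinateIdeal P r j :=
  coordinateIdeal_le P (map_C_le_coordinateIdeal P r j) fun a ha =>
    (X_mem_coordinateIdeal_iff hP a).2 (ha.trans_le hij)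

/-- Let `R[It]` be integral over `R[T₁, …, T_r]`, `Tᵢ ↦ xᵢ t`, where `r = ℓ(I)`. Then some prime of
`R[It]` lies over `𝔪 R[T₁, …, T_r]`, because the special fiber ring has the same dimension as the
polynomial ring over the residue field. -/
theorem exists_prime_over_map_maximalIdeal {R : Type u} [CommRing R] [IsNoetherianRing R]
    [IsLocalRing R] {I : Ideal R} {r : ℕ} (hl : analyticSpread I = r) (x : Fin r → I)
    (hint : (polyToRees I x).toRingHom.IsIntegral) :
    ∃ P : Ideal (reesAlgebra I), P.IsPrime ∧
      P.comap (polyToRees I x).toRingHom = (IsLocalRing.maximalIdeal R).map MvPolynomial.C := by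
  let ψ : MvPolynomial (Fin r) (IsLocalRing.ResidueField R) →+* SpecialFiberRing I :=
    MvPolynomial.eval₂Hom (fiberScalar I) fun i => fiberMap I (reesLinear I (x i))
  have hψ : ψ.comp (MvPolynomial.map (IsLocalRing.residue R)) =
      (fiberMap I).comp (polyToRees I x).toRingHom := by
    refine MvPolynomial.ringHom_ext (fun c => ?_) fun i => ?_
    · simp only [RingHom.comp_apply, MvPolynomial.map_C, ψ, MvPolynomial.eval₂Hom_C]
      change _ = fiberMap I (polyToRees I x (MvPolynomial.C c))
      rw [MvPolynomial.algHom_C]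
      rfl
    · simp only [RingHom.comp_apply, MvPolynomial.map_X, ψ, MvPolynomial.eval₂Hom_X']
      change _ = fiberMap I (polyToRees I x (MvPolynomial.X i))
      rw [polyToRees, MvPolynomial.aeval_X]
  have hψint : ψ.IsIntegral := by
    refine RingHom.IsIntegral.tower_top (MvPolynomial.map (IsLocalRing.residue R)) ψ ?_
    rw [hψ]
    exact RingHom.IsIntegral.trans _ _ hint
      ((fiberMap I).isIntegral_of_surjective (fiberMap_surjective I))
  have hdim : ringKrullDim (MvPolynomial (Fin r) (IsLocalRing.ResidueField R)) = r := by
    rw [MvPolynomial.ringKrullDim_of_isNoetherianRing, ringKrullDim_eq_zero_of_field]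
    simp
  obtain ⟨p, hp, hp0⟩ := exists_isPrime_comap_eq_bot ψ hψint hdim hl
  refine ⟨p.comap (fiberMap I), Ideal.comap_isPrime _ _, ?_⟩
  rw [Ideal.comap_comap, ← hψ, ← Ideal.comap_comap, hp0, ← RingHom.ker_eq_comap_bot,
    MvPolynomial.ker_map, IsLocalRing.ker_residue]

/-- Going up along `R[T₁, …, T_r] → R[It]` from a prime over `𝔪 R[T]` to a prime over
`(𝔪, T₁, …, T_j)` raises the height by at least `j`. -/
theorem exists_prime_over_coordinateIdeal {R : Type u} [CommRing R] [IsLocalRing R] {I : Ideal R}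
    {r : ℕ} (x : Fin r → I) (hint : (polyToRees I x).toRingHom.IsIntegral)
    {P : Ideal (reesAlgebra I)} [P.IsPrime]
    (hP : P.comap (polyToRees I x).toRingHom = (IsLocalRing.maximalIdeal R).map MvPolynomial.C)
    (j : ℕ) (hj : j ≤ r) :
    ∃ Q : Ideal (reesAlgebra I), Q.IsPrime ∧
      Q.comap (polyToRees I x).toRingHom = coordinateIdeal (IsLocalRing.maximalIdeal R) r j ∧
      P ≤ Q ∧ P.height + j ≤ Q.height := by
  have hm : IsLocalRing.maximalIdeal R ≠ ⊤ := Ideal.IsPrime.ne_top'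
  let _ : Algebra (MvPolynomial (Fin r) R) (reesAlgebra I) := (polyToRees I x).toRingHom.toAlgebra
  have : Algebra.IsIntegral (MvPolynomial (Fin r) R) (reesAlgebra I) := ⟨hint⟩
  induction j with
  | zero => exact ⟨P, inferInstance, by rw [hP, coordinateIdeal_zero], le_rfl, by simp⟩
  | succ j ih =>
    obtain ⟨Q, hQ, hQc, hPQ, hQh⟩ := ih (by omega)
    obtain ⟨Q', hQQ', hQ', hQ'c⟩ := Ideal.exists_ideal_over_prime_of_isIntegral_of_isPrime
      (coordinateIdeal (IsLocalRing.maximalIdeal R) r (j + 1)) Q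
      (hQc.le.trans (coordinateIdeal_mono hm j.le_succ))
    refine ⟨Q', hQ', hQ'c, hPQ.trans hQQ', ?_⟩
    have hne : Q ≠ Q' := by
      rintro rfl
      have h1 : coordinateIdeal (IsLocalRing.maximalIdeal R) r j =
        coordinateIdeal (IsLocalRing.maximalIdeal R) r (j + 1) := hQc.symm.trans hQ'c
      have h2 := (X_mem_coordinateIdeal_iff (j := j + 1) hm ⟨j, hj⟩).2 j.lt_succ_self
      rw [← h1, X_mem_coordinateIdeal_iff hm] at h2
      exact lt_irrefl _ h2
    have := Ideal.height_add_one_le_of_lt_of_isPrime (lt_of_le_of_ne hQQ' hne)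
    refine le_trans ?_ this
    rw [Nat.cast_succ, ← add_assoc]
    gcongr

/-- The elements of a minimal prime `P` become nilpotent in the localization at `P`. -/
theorem exists_notMem_mul_pow_eq_zero {A : Type*} [CommRing A] {P : Ideal A} [P.IsPrime]
    (hP : P.height = 0) {a : A} (ha : a ∈ P) : ∃ y ∉ P, ∃ k, y * a ^ k = 0 := by
  have h1 : algebraMap A (Localization.AtPrime P) a ∈ nilradical (Localization.AtPrime P) := by
    rw [nilradical_eq_sInf, Ideal.mem_sInf]
    intro q hq
    have hq' : q.IsPrime := hq
    have hle : q.comap (algebraMap A (Localization.AtPrime P)) ≤ P :=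
      (Ideal.comap_mono (IsLocalRing.le_maximalIdeal hq'.ne_top)).trans
        (Localization.AtPrime.under_maximalIdeal (I := P)).le
    have hPmin := Ideal.height_eq_zero_iff.1 hP
    exact hPmin.2 ⟨Ideal.comap_isPrime _ _, bot_le⟩ hle ha
  obtain ⟨k, hk⟩ := h1
  rw [← map_pow, Ideal.zero_eq_bot, Ideal.mem_bot,
    IsLocalization.map_eq_zero_iff P.primeCompl] at hk
  obtain ⟨y, hy⟩ := hk
  exact ⟨y, y.2, k, hy⟩

/-- If `J` is a reduction of `I` with `ℓ(I)` generators and `J_{d-1}` agrees with `I` on the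
punctured spectrum, then no power of `I` lies in `J_{d-1}`. -/
theorem residualIdeal_ne_top {R : Type u} [CommRing R] [IsNoetherianRing R] [IsLocalRing R]
    {n : ℕ} {I : Ideal R} (hIm : I ≤ IsLocalRing.maximalIdeal R)
    (hl : analyticSpread I = (n + 1 : ℕ)) {x : Fin (n + 1) → R} (hxI : ∀ i, x i ∈ I)
    {C : Ideal R} {s N : ℕ} (hs : IsLocalRing.maximalIdeal R ^ s ≤ I ⊔ C)
    (hC : C * I ≤ initialIdeal x n) (hred : I ^ (N + 1) = fullIdeal x * I ^ N) :
    residualIdeal I x ≠ ⊤ := by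
  intro hK
  obtain ⟨t, -, ht⟩ : (1 : R) ∈ colonPowers (initialIdeal x n) I := by
    have : (1 : R) ∈ residualIdeal I x := hK ▸ Submodule.mem_top
    exact this
  simp only [one_mul] at ht
  have hm : IsLocalRing.maximalIdeal R ≠ ⊤ := Ideal.IsPrime.ne_top'
  let x' : Fin (n + 1) → I := fun i => ⟨x i, hxI i⟩
  set φ := polyToRees I x' with hφ
  have hint : φ.toRingHom.IsIntegral := RingHom.Finite.to_isIntegral (polyToRees_finite x' hred)
  have hφX : ∀ i, φ (MvPolynomial.X i) = reesLinear I (x' i) := fun i => by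
    rw [hφ, polyToRees, MvPolynomial.aeval_X]
  have hφC : ∀ c, φ (MvPolynomial.C c) = algebraMap R _ c := fun c => MvPolynomial.algHom_C φ c
  have hX : ∀ (L : Ideal (reesAlgebra I)) (i : Fin (n + 1)),
      MvPolynomial.X i ∈ L.comap φ.toRingHom ↔ reesLinear I (x' i) ∈ L := fun L i => by
    rw [← hφX]
    rfl
  have hc : ∀ (L : Ideal (reesAlgebra I)) (c : R),
      MvPolynomial.C c ∈ L.comap φ.toRingHom ↔ algebraMap R (reesAlgebra I) c ∈ L := fun L c => by
    rw [← hφC]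
    rfl
  obtain ⟨P, hP, hPc⟩ := exists_prime_over_map_maximalIdeal hl x' hint
  obtain ⟨Q, hQ, hQc, hPQ, hQh⟩ := exists_prime_over_coordinateIdeal x' hint hPc n n.le_succ
  -- the ideal generated by `x₁ t, …, x_n t`, which has `Q` as a minimal prime
  let gen : Set (reesAlgebra I) := Set.range fun i : Fin n => reesLinear I (x' i.castSucc)
  have hcolon : ∀ c ∈ IsLocalRing.maximalIdeal R ^ (s * t),
      c * x (Fin.last n) ∈ initialIdeal x n := by
    intro c hc
    rw [pow_mul] at hc
    have h1 : c ∈ I ^ t ⊔ C := sup_pow_le_pow_sup _ _ _ (Ideal.pow_right_mono hs _ hc)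
    obtain ⟨u, hu, v, hv, rfl⟩ := Submodule.mem_sup.1 h1
    rw [add_mul]
    exact Ideal.add_mem _ (Ideal.mul_mem_right _ _ (ht u hu)) (hC (Ideal.mul_mem_mul hv (hxI _)))
  have hgen : ∀ (y : R) (hy : y ∈ initialIdeal x n), ∃ hyI : y ∈ I,
      reesLinear I ⟨y, hyI⟩ ∈ Ideal.span gen := by
    intro y hy
    induction hy using Submodule.span_induction with
    | mem y hy =>
      obtain ⟨i, hi, rfl⟩ := hy
      exact ⟨hxI i, Ideal.subset_span ⟨⟨i, hi⟩, rfl⟩⟩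
    | zero =>
      exact ⟨I.zero_mem, (map_zero (reesLinear I)).symm ▸ Ideal.zero_mem _⟩
    | add y z _ _ hy hz =>
      obtain ⟨hy, hy'⟩ := hy
      obtain ⟨hz, hz'⟩ := hz
      exact ⟨I.add_mem hy hz,
        (map_add (reesLinear I) ⟨y, hy⟩ ⟨z, hz⟩).symm ▸ Ideal.add_mem _ hy' hz'⟩
    | smul c y _ hy =>
      obtain ⟨hy, hy'⟩ := hy
      refine ⟨I.mul_mem_left c hy, (map_smul (reesLinear I) c ⟨y, hy⟩).symm ▸ ?_⟩
      rw [Algebra.smul_def]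
      exact Ideal.mul_mem_left _ _ hy'
  have hlast : ∀ Q' : Ideal (reesAlgebra I), Q' ≤ Q → reesLinear I (x' (Fin.last n)) ∉ Q' := by
    intro Q' hQ' hmem
    have h1 : MvPolynomial.X (Fin.last n) ∈
        coordinateIdeal (IsLocalRing.maximalIdeal R) (n + 1) n := by
      rw [← hQc, hX]
      exact hQ' hmem
    rw [X_mem_coordinateIdeal_iff hm] at h1
    simp at h1
  have hmin : Q ∈ (Ideal.span gen).minimalPrimes := by
    refine ⟨⟨hQ, ?_⟩, ?_⟩
    · rw [Ideal.span_le]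
      rintro _ ⟨i, rfl⟩
      have h1 : MvPolynomial.X i.castSucc ∈
          coordinateIdeal (IsLocalRing.maximalIdeal R) (n + 1) n :=
        (X_mem_coordinateIdeal_iff hm _).2 (by simp)
      rwa [← hQc, hX] at h1
    · rintro Q' ⟨hQ', hgQ'⟩ hQ'Q
      -- `Q'` contains `𝔪`, since `𝔪^{st} xₙ₊₁ ⊆ (x₁, …, xₙ)` and `xₙ₊₁ t ∉ Q'`
      have hmQ' : (IsLocalRing.maximalIdeal R).map (algebraMap R (reesAlgebra I)) ≤ Q' := by
        refine Ideal.IsPrime.le_of_pow_le (n := s * t) ?_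
        rw [← Ideal.map_pow, Ideal.map_le_iff_le_comap]
        intro c hc
        obtain ⟨_, h2⟩ := hgen _ (hcolon c hc)
        have h3 : algebraMap R (reesAlgebra I) c * reesLinear I (x' (Fin.last n)) ∈ Q' := by
          rw [← Algebra.smul_def, ← map_smul]
          exact hgQ' h2
        exact (hQ'.mem_or_mem h3).resolve_right (hlast Q' hQ'Q)
      have hcomap : Q'.comap φ.toRingHom = Q.comap φ.toRingHom := by
        refine le_antisymm (Ideal.comap_mono hQ'Q) ?_
        rw [hQc]
        refine coordinateIdeal_le _ ?_ fun i hi => ?_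
        · rw [Ideal.map_le_iff_le_comap]
          intro c hcm
          exact (hc Q' c).2 (hmQ' (Ideal.mem_map_of_mem _ hcm))
        · exact (hX Q' i).2 (hgQ' (Ideal.subset_span ⟨⟨i, hi⟩, rfl⟩))
      by_contra hne
      let _ : Algebra (MvPolynomial (Fin (n + 1)) R) (reesAlgebra I) := φ.toRingHom.toAlgebra
      have : Algebra.IsIntegral (MvPolynomial (Fin (n + 1)) R) (reesAlgebra I) := ⟨hint⟩
      have hlt := Ideal.IsIntegral.comap_lt_comap (R := MvPolynomial (Fin (n + 1)) R)
        (lt_of_le_not_ge hQ'Q hne)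
      exact hlt.ne hcomap
  have hht : Q.height ≤ n := by
    refine (Ideal.height_le_card_of_mem_minimalPrimes_span (Set.finite_range _) hmin).trans ?_
    have : gen.ncard ≤ n := by
      simpa [gen] using! (Set.ncard_image_le (f := fun i : Fin n => reesLinear I (x' i.castSucc))
        (Set.finite_univ))
    exact_mod_cast this
  have hP0 : P.height = 0 := by
    have h1 : P.height + n ≤ 0 + n := by
      rw [zero_add]
      exact hQh.trans hht
    exact le_antisymm ((ENat.add_le_add_iff_right (ENat.natCast_ne_top n)).1 h1) bot_le
  -- hence `P` is a minimal prime of `R[It]` containing `xₙ₊₁`, and so contains `xₙ₊₁ t`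
  have hxP : algebraMap R (reesAlgebra I) (x (Fin.last n)) ∈ P := by
    rw [← hc, hPc]
    exact Ideal.mem_map_of_mem _ (hIm (hxI _))
  obtain ⟨y, hy, k, hk⟩ := exists_notMem_mul_pow_eq_zero hP0 hxP
  refine hlast P hPQ ?_
  refine hP.mem_of_pow_mem k ((hP.mem_or_mem (?_ : y * _ ∈ P)).resolve_left hy)
  -- in the polynomial ring `R[t]`, the relation `y xᵏ = 0` gives `y (xt)ᵏ = 0`
  suffices h : y * reesLinear I (x' (Fin.last n)) ^ k = 0 from h ▸ P.zero_mem
  apply Subtype.ext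
  have h1 := congrArg (Subtype.val) hk
  rw [MulMemClass.coe_mul, SubmonoidClass.coe_pow] at h1 ⊢
  have h2 : (reesLinear I (x' (Fin.last n)) : Polynomial R) =
      ((algebraMap R (reesAlgebra I) (x (Fin.last n)) : reesAlgebra I) : Polynomial R) *
        Polynomial.X := by
    rw [coe_reesLinear]
    exact (Polynomial.C_mul_X_eq_monomial).symm
  rw [h2, mul_pow, ← mul_assoc, h1, ZeroMemClass.coe_zero, zero_mul]

/-! ### Clearing denominators at a prime -/

/-- An inclusion `𝔞_P ⊆ 𝔟_P` with `𝔞` finitely generated has a common denominator. -/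
theorem exists_notMem_mul_mem_of_map_le {A : Type*} [CommRing A] {P : Ideal A} [P.IsPrime]
    {𝔞 𝔟 : Ideal A} (h𝔞 : 𝔞.FG)
    (h : 𝔞.map (algebraMap A (Localization.AtPrime P)) ≤
      𝔟.map (algebraMap A (Localization.AtPrime P))) :
    ∃ f ∉ P, ∀ z ∈ 𝔞, f * z ∈ 𝔟 := by
  classical
  obtain ⟨S, rfl⟩ := h𝔞
  have key : ∀ T : Finset A, T ⊆ S → ∃ f ∉ P, ∀ z ∈ T, f * z ∈ 𝔟 := by
    intro T
    induction T using Finset.induction_on with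
    | empty => intro _; exact ⟨1, P.one_notMem, by simp⟩
    | insert a T _ ih =>
      intro hT
      rw [Finset.insert_subset_iff] at hT
      obtain ⟨f, hf, hfT⟩ := ih hT.2
      obtain ⟨⟨b, g⟩, hbg⟩ := (IsLocalization.mem_map_algebraMap_iff P.primeCompl _).1
        (h (Ideal.mem_map_of_mem _ (Ideal.subset_span hT.1)))
      simp only at hbg
      rw [← map_mul, IsLocalization.eq_iff_exists P.primeCompl] at hbg
      obtain ⟨g', hg'⟩ := hbg
      refine ⟨f * (g' * g), ?_, ?_⟩
      · intro hmem
        rcases ‹P.IsPrime›.mem_or_mem hmem with h1 | h1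
        · exact hf h1
        · exact (g' * g).2 h1
      · intro z hz
        rcases Finset.mem_insert.1 hz with rfl | hz
        · have : f * (g' * g) * z = f * (g' * (z * g)) := by ring
          rw [this, hg']
          exact 𝔟.mul_mem_left _ (𝔟.mul_mem_left _ b.2)
        · have : f * (g' * g) * z = g' * g * (f * z) := by ring
          rw [this]
          exact 𝔟.mul_mem_left _ (hfT z hz)
  obtain ⟨f, hf, hfS⟩ := key S subset_rfl
  refine ⟨f, hf, fun z hz => ?_⟩
  have : Ideal.span (S : Set A) ≤ 𝔟.colon {f} := Ideal.span_le.2 fun w hw => by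
    rw [SetLike.mem_coe, Submodule.mem_colon_singleton, smul_eq_mul, mul_comm]
    exact hfS w hw
  have := Submodule.mem_colon_singleton.1 (this hz)
  rwa [smul_eq_mul, mul_comm] at this

/-- If every prime of `A_P` containing `𝔟` contains `𝔠`, then `f 𝔠ˢ ⊆ 𝔟` for some `f ∉ P`. -/
theorem exists_notMem_mul_pow_mem {A : Type*} [CommRing A] [IsNoetherianRing A] {P : Ideal A}
    [P.IsPrime] {𝔟 𝔠 : Ideal A} (h : ∀ Q : Ideal A, Q.IsPrime → 𝔟 ≤ Q → Q ≤ P → 𝔠 ≤ Q) :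
    ∃ f ∉ P, ∃ s : ℕ, ∀ z ∈ 𝔠 ^ s, f * z ∈ 𝔟 := by
  have h1 : 𝔠.map (algebraMap A (Localization.AtPrime P)) ≤
      (𝔟.map (algebraMap A (Localization.AtPrime P))).radical := by
    rw [Ideal.radical_eq_sInf, le_sInf_iff]
    rintro q ⟨hq, hq'⟩
    rw [Ideal.map_le_iff_le_comap] at hq ⊢
    refine h _ (Ideal.comap_isPrime _ _) hq ?_
    exact (Ideal.comap_mono (IsLocalRing.le_maximalIdeal hq'.ne_top)).trans
        (Localization.AtPrime.under_maximalIdeal (I := P)).le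
  obtain ⟨s, hs⟩ := Ideal.exists_pow_le_of_le_radical_of_fg h1 (IsNoetherian.noetherian _)
  rw [← Ideal.map_pow] at hs
  obtain ⟨f, hf, hf'⟩ := exists_notMem_mul_mem_of_map_le (IsNoetherian.noetherian _) hs
  exact ⟨f, hf, s, hf'⟩

/-! ### Generic linear combinations of generators -/

theorem height_le_height_map_C {A σ : Type*} [CommRing A] (P : Ideal A) [P.IsPrime] :
    P.height ≤ (P.map (MvPolynomial.C : A →+* MvPolynomial σ A)).height := by
  have hprime : ∀ Q : PrimeSpectrum A,
      (Q.asIdeal.map (MvPolynomial.C : A →+* MvPolynomial σ A)).IsPrime :=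
    fun Q => MvPolynomial.isPrime_map_C Q.asIdeal
  have hcomap : ∀ Q : Ideal A,
      (Q.map (MvPolynomial.C : A →+* MvPolynomial σ A)).comap MvPolynomial.C = Q := fun Q => by
    refine le_antisymm (fun z hz => ?_) Ideal.le_comap_map
    simpa using MvPolynomial.mem_map_C_iff.1 hz 0
  let F : PrimeSpectrum A → PrimeSpectrum (MvPolynomial σ A) := fun Q => ⟨_, hprime Q⟩
  have hF : StrictMono F := by
    intro Q Q' h
    refine lt_of_le_of_ne (Ideal.map_mono (le_of_lt h)) fun he => h.ne ?_
    have := congrArg (fun q => Ideal.comap MvPolynomial.C (PrimeSpectrum.asIdeal q)) he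
    simp only [F, hcomap] at this
    exact PrimeSpectrum.ext this
  have := Order.height_le_height_apply_of_strictMono F hF ⟨P, inferInstance⟩
  rwa [← PrimeSpectrum.height_eq_orderHeight, ← PrimeSpectrum.height_eq_orderHeight] at this

theorem height_map_C_le {A σ : Type*} [CommRing A] [Finite σ] [IsNoetherianRing A] (P : Ideal A)
    [P.IsPrime] : (P.map (MvPolynomial.C : A →+* MvPolynomial σ A)).height ≤ P.height := by
  classical
  obtain ⟨S, hS, hcard⟩ := P.exists_finset_card_eq_height_of_isNoetherianRing
  have hprime := MvPolynomial.isPrime_map_C (σ := σ) P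
  rw [← hcard]
  have hmin : P.map (MvPolynomial.C : A →+* MvPolynomial σ A) ∈
      (Ideal.span ((S.image (MvPolynomial.C : A →+* MvPolynomial σ A) : Finset _) :
        Set (MvPolynomial σ A))).minimalPrimes := by
    rw [Finset.coe_image, ← Ideal.map_span]
    refine ⟨⟨hprime, Ideal.map_mono hS.1.2⟩, ?_⟩
    rintro Q ⟨hQ, hSQ⟩ hQP
    rw [Ideal.map_le_iff_le_comap] at hSQ ⊢
    refine hS.2 ⟨Ideal.comap_isPrime _ _, hSQ⟩ fun z hz => ?_
    simpa using MvPolynomial.mem_map_C_iff.1 (hQP hz) 0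
  refine (Ideal.height_le_card_of_mem_minimalPrimes_span_finset hmin).trans ?_
  exact_mod_cast Finset.card_image_le

/-- At every prime `P ⊇ I` of height at most `h < d`, the module `I / J` is locally generated by
`h - i` elements (by none if `h ≤ i`): there are elements `T` of `I` in that number and `s ∉ P` with
`s I ⊆ J + (T)`. For `i = 0` and `J = 0` this is the condition `G_d`. -/
def ResidualGeneratorBound {A : Type*} [CommRing A] (I J : Ideal A) (d i : ℕ) : Prop :=
  ∀ P : Ideal A, P.IsPrime → I ≤ P → ∀ h : ℕ, P.height ≤ h → h < d →
    ∃ T : Finset A, T.card ≤ h - i ∧ (∀ y ∈ T, y ∈ I) ∧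
      ∃ s ∉ P, ∀ a ∈ I, s * a ∈ J ⊔ Ideal.span T

theorem ResidualGeneratorBound.mono {A : Type*} [CommRing A] {I J J' : Ideal A} {d i : ℕ}
    (h : ResidualGeneratorBound I J d i) (hJ : J ≤ J') : ResidualGeneratorBound I J' d i := by
  intro P hP hIP k hk hkd
  obtain ⟨T, hT, hTI, s, hs, hsI⟩ := h P hP hIP k hk hkd
  exact ⟨T, hT, hTI, s, hs, fun a ha => sup_le_sup_right hJ _ (hsI a ha)⟩

theorem ResidualGeneratorBound.map_equiv {A B : Type*} [CommRing A] [CommRing B] (e : A ≃+* B)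
    {I J : Ideal A} {d i : ℕ} (h : ResidualGeneratorBound I J d i) :
    ResidualGeneratorBound (I.map (e : A →+* B)) (J.map (e : A →+* B)) d i := by
  classical
  intro P hP hIP k hk hkd
  obtain ⟨T, hT, hTI, s, hs, hsI⟩ := h (P.comap (e : A →+* B)) (Ideal.comap_isPrime _ _)
    (Ideal.map_le_iff_le_comap.1 hIP) k ((RingEquiv.height_comap e P).trans_le hk) hkd
  refine ⟨T.image e, Finset.card_image_le.trans hT, ?_, e s, hs, ?_⟩
  · intro y hy
    obtain ⟨z, hz, rfl⟩ := Finset.mem_image.1 hy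
    exact Ideal.mem_map_of_mem (e : A →+* B) (hTI z hz)
  · intro b hb
    obtain ⟨a, ha, rfl⟩ := (Ideal.mem_map_iff_of_surjective (e : A →+* B) e.surjective).1 hb
    have := Ideal.mem_map_of_mem (e : A →+* B) (hsI a ha)
    rw [Ideal.map_sup, Ideal.map_span] at this
    rw [Finset.coe_image]
    simpa using this

/-- A generic linear combination `x = ∑ X_j a_j` of generators of `I` lowers the number of local
generators of `I / J` by one at the primes extended from the base, and all other primes have larger
height than the extension of their contraction. -/
theorem ResidualGeneratorBound.step {A : Type*} [CommRing A] {I J : Ideal A} {d i t : ℕ}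
    (a : Fin t → A) (hI : Ideal.span (Set.range a) = I) (h : ResidualGeneratorBound I J d i) :
    ResidualGeneratorBound (I.map (MvPolynomial.C : A →+* MvPolynomial (Fin t) A))
      (J.map MvPolynomial.C ⊔
        Ideal.span {∑ j, MvPolynomial.X j * MvPolynomial.C (a j)}) d (i + 1) := by
  classical
  have haI : ∀ j, a j ∈ I := fun j => hI ▸ Ideal.subset_span ⟨j, rfl⟩
  intro P hP hIP k hk hkd
  set Q : Ideal A := P.comap MvPolynomial.C with hQdef
  have hQ : Q.IsPrime := Ideal.comap_isPrime _ _
  have hIQ : I ≤ Q := Ideal.map_le_iff_le_comap.1 hIP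
  have hQP : Q.map MvPolynomial.C ≤ P := Ideal.map_comap_le
  have hext := MvPolynomial.isPrime_map_C (σ := Fin t) Q
  -- it suffices to treat the extensions of the generators of `I`
  have hred : ∀ (f : MvPolynomial (Fin t) A) (L : Ideal (MvPolynomial (Fin t) A)),
      (∀ z ∈ I, f * MvPolynomial.C z ∈ L) → ∀ z ∈ I.map MvPolynomial.C, f * z ∈ L := by
    intro f L hfL z hz
    have hle : I.map MvPolynomial.C ≤ L.colon {f} := by
      rw [Ideal.map_le_iff_le_comap]
      intro w hw
      rw [Ideal.mem_comap, Submodule.mem_colon_singleton, smul_eq_mul, mul_comm]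
      exact hfL w hw
    have := Submodule.mem_colon_singleton.1 (hle hz)
    rwa [smul_eq_mul, mul_comm] at this
  have himage : ∀ (T : Finset A) (z : A), z ∈ J ⊔ Ideal.span T →
      MvPolynomial.C z ∈ J.map (MvPolynomial.C : A →+* MvPolynomial (Fin t) A) ⊔
        Ideal.span {∑ j, MvPolynomial.X j * MvPolynomial.C (a j)} ⊔
        Ideal.span (T.image (MvPolynomial.C : A →+* MvPolynomial (Fin t) A) : Finset _) := by
    intro T z hz
    have := Ideal.mem_map_of_mem (MvPolynomial.C : A →+* MvPolynomial (Fin t) A) hz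
    rw [Ideal.map_sup, Ideal.map_span, ← Finset.coe_image] at this
    exact SetLike.le_def.1 (sup_le_sup_right le_sup_left _) this
  -- a set of local generators of `I / J` at `Q` that is small enough
  have hcase1 : ∀ T : Finset A, T.card ≤ k - (i + 1) → (∀ y ∈ T, y ∈ I) →
      (∃ s ∉ Q, ∀ z ∈ I, s * z ∈ J ⊔ Ideal.span T) →
      ∃ T : Finset (MvPolynomial (Fin t) A), T.card ≤ k - (i + 1) ∧
        (∀ y ∈ T, y ∈ I.map MvPolynomial.C) ∧ ∃ s ∉ P, ∀ z ∈ I.map MvPolynomial.C,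
          s * z ∈ J.map MvPolynomial.C ⊔
            Ideal.span {∑ j, MvPolynomial.X j * MvPolynomial.C (a j)} ⊔ Ideal.span T := by
    rintro T hT hTI ⟨s, hs, hsI⟩
    refine ⟨T.image MvPolynomial.C, Finset.card_image_le.trans hT, ?_, MvPolynomial.C s, hs,
      hred _ _ fun z hz => ?_⟩
    · intro y hy
      obtain ⟨z, hz, rfl⟩ := Finset.mem_image.1 hy
      exact Ideal.mem_map_of_mem _ (hTI z hz)
    · rw [← map_mul]
      exact himage T _ (hsI z hz)
  by_cases hPQ : Q.map MvPolynomial.C = P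
  · obtain ⟨T, hT, hTI, s, hs, hsI⟩ := h Q hQ hIQ k
      ((height_le_height_map_C (σ := Fin t) Q).trans (hPQ ▸ hk)) hkd
    by_cases hTe : T = ∅
    · exact hcase1 T (by simp [hTe]) hTI ⟨s, hs, hsI⟩
    obtain ⟨y, hy⟩ := Finset.nonempty_iff_ne_empty.2 hTe
    set T₀ := T.erase y with hT₀
    have hins : insert y T₀ = T := Finset.insert_erase hy
    have hcard : T₀.card ≤ k - (i + 1) := by
      rw [hT₀, Finset.card_erase_of_mem hy]
      omega
    have hT₀I : ∀ z ∈ T₀, z ∈ I := fun z hz => hTI z (Finset.mem_of_mem_erase hz)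
    have hdec : ∀ z ∈ I, ∃ b u, u ∈ J ⊔ Ideal.span (T₀ : Set A) ∧ s * z = u + b * y := by
      intro z hz
      have := hsI z hz
      rw [← hins, Finset.coe_insert, Ideal.span_insert, ← sup_assoc, sup_comm J, sup_assoc,
        Submodule.mem_sup] at this
      obtain ⟨v, hv, u, hu, hvu⟩ := this
      obtain ⟨b, rfl⟩ := Ideal.mem_span_singleton'.1 hv
      exact ⟨b, u, hu, by rw [← hvu, add_comm]⟩
    choose b u hu hbu using fun j => hdec (a j) (haI j)
    -- it suffices that some `f ∉ P` brings `y` into the ideal generated by the other elements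
    have hfinish : ∀ f : MvPolynomial (Fin t) A, f ∉ P →
        f * MvPolynomial.C y ∈ J.map (MvPolynomial.C : A →+* MvPolynomial (Fin t) A) ⊔
          Ideal.span {∑ j, MvPolynomial.X j * MvPolynomial.C (a j)} ⊔
          Ideal.span (T₀.image (MvPolynomial.C : A →+* MvPolynomial (Fin t) A) : Finset _) →
        ∃ T : Finset (MvPolynomial (Fin t) A), T.card ≤ k - (i + 1) ∧
        (∀ y ∈ T, y ∈ I.map MvPolynomial.C) ∧ ∃ s ∉ P, ∀ z ∈ I.map MvPolynomial.C,
          s * z ∈ J.map MvPolynomial.C ⊔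
            Ideal.span {∑ j, MvPolynomial.X j * MvPolynomial.C (a j)} ⊔ Ideal.span T := by
      intro f hf hfy
      refine ⟨T₀.image MvPolynomial.C, Finset.card_image_le.trans hcard, ?_,
        f * MvPolynomial.C s, fun hmem => (hP.mem_or_mem hmem).elim hf hs,
        hred _ _ fun z hz => ?_⟩
      · intro y hy
        obtain ⟨z, hz, rfl⟩ := Finset.mem_image.1 hy
        exact Ideal.mem_map_of_mem _ (hT₀I z hz)
      · obtain ⟨c, v, hv, hcv⟩ := hdec z hz
        have : f * MvPolynomial.C s * MvPolynomial.C z =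
            f * MvPolynomial.C v + MvPolynomial.C c * (f * MvPolynomial.C y) := by
          rw [mul_assoc, ← map_mul, hcv, map_add, map_mul]
          ring
        rw [this]
        exact Ideal.add_mem _ (Ideal.mul_mem_left _ _ (himage T₀ v hv)) (Ideal.mul_mem_left _ _ hfy)
    by_cases hb : ∀ j, b j ∈ Q
    · -- then `y` is superfluous already over `A`
      obtain ⟨c, hc⟩ : ∃ c : Fin t → A, ∑ j, c j * a j = y := by
        have : y ∈ Ideal.span (Set.range a) := hI ▸ hTI y hy
        exact (Ideal.mem_span_range_iff_exists_fun).1 this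
      have hrel : (s - ∑ j, c j * b j) * y = ∑ j, c j * u j := by
        have h1 : s * y = ∑ j, c j * (u j + b j * y) := by
          simp_rw [← hbu]
          rw [← hc, Finset.mul_sum]
          exact Finset.sum_congr rfl fun j _ => by ring
        rw [sub_mul, h1, Finset.sum_mul, ← Finset.sum_sub_distrib]
        exact Finset.sum_congr rfl fun j _ => by ring
      refine hfinish (MvPolynomial.C (s - ∑ j, c j * b j)) (fun hmem => hs ?_) ?_
      · have h1 : s - ∑ j, c j * b j ∈ Q := hmem
        have h2 : ∑ j, c j * b j ∈ Q := Q.sum_mem fun j _ => Q.mul_mem_left _ (hb j)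
        simpa using Q.add_mem h1 h2
      · rw [← map_mul, hrel]
        exact himage T₀ _ (Ideal.sum_mem _ fun j _ => Ideal.mul_mem_left _ _ (hu j))
    · -- the generic element replaces `y`
      push Not at hb
      obtain ⟨j₀, hj₀⟩ := hb
      refine hfinish (∑ j, MvPolynomial.X j * MvPolynomial.C (b j)) (fun hmem => hj₀ ?_) ?_
      · rw [← hPQ] at hmem
        have := MvPolynomial.mem_map_C_iff.1 hmem (Finsupp.single j₀ 1)
        rw [MvPolynomial.coeff_sum] at this
        simpa [mul_comm (MvPolynomial.X _), MvPolynomial.coeff_C_mul, MvPolynomial.coeff_X,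
          Finsupp.single_left_inj] using this
      · have h1 : (∑ j, MvPolynomial.X j * MvPolynomial.C (b j)) * MvPolynomial.C y =
            MvPolynomial.C s * (∑ j, MvPolynomial.X j * MvPolynomial.C (a j)) -
              ∑ j, MvPolynomial.X j * (MvPolynomial.C (u j) : MvPolynomial (Fin t) A) := by
          rw [Finset.mul_sum, ← Finset.sum_sub_distrib, Finset.sum_mul]
          refine Finset.sum_congr rfl fun j _ => ?_
          have h2 : (MvPolynomial.C s * MvPolynomial.C (a j) : MvPolynomial (Fin t) A) =
              MvPolynomial.C (u j) + MvPolynomial.C (b j) * MvPolynomial.C y := by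
            rw [← map_mul, hbu, map_add, map_mul]
          linear_combination (-MvPolynomial.X j) * h2
        rw [h1]
        refine Ideal.sub_mem _ (Ideal.mul_mem_left _ _ ?_)
          (Ideal.sum_mem _ fun j _ => Ideal.mul_mem_left _ _ (himage T₀ _ (hu j)))
        exact Ideal.mem_sup_left (Ideal.mem_sup_right (Ideal.mem_span_singleton_self _))
  · have hlt := Ideal.height_add_one_le_of_lt_of_isPrime (lt_of_le_of_ne hQP hPQ)
    have h1 : Q.height + 1 ≤ k := by
      refine le_trans ?_ (hlt.trans hk)
      gcongr
      exact height_le_height_map_C Q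
    obtain ⟨q, hq⟩ : ∃ q : ℕ, Q.height = q := by
      refine ENat.ne_top_iff_exists.1 (fun htop => ?_) |>.imp fun _ => Eq.symm
      rw [htop, top_add, top_le_iff] at h1
      exact ENat.natCast_ne_top k h1
    rw [hq] at h1
    have h2 : q + 1 ≤ k := by exact_mod_cast h1
    obtain ⟨T, hT, hTI, hs⟩ := h Q hQ hIQ q hq.le (by omega)
    exact hcase1 T (by omega) hTI hs

theorem residualGeneratorBound_of_satisfiesG {R : Type u} [CommRing R] [IsNoetherianRing R]
    {I : Ideal R} {d : ℕ} (hG : SatisfiesG I d) : ResidualGeneratorBound I ⊥ d 0 := by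
  classical
  intro P hP hIP k hk hkd
  obtain ⟨i, hi⟩ : ∃ i : ℕ, P.height = i :=
    (ENat.ne_top_iff_exists.1 (ne_top_of_le_ne_top (ENat.natCast_ne_top k) hk)).imp
      fun _ => Eq.symm
  have hik : i ≤ k := by
    rw [hi] at hk
    exact_mod_cast hk
  obtain ⟨y, hyI, hy⟩ := hG P hIP i hi (by omega)
  obtain ⟨s, hs, hsI⟩ := exists_notMem_mul_mem_of_map_le (IsNoetherian.noetherian I) hy.le
  refine ⟨Finset.univ.image y, (Finset.card_image_le.trans (by simp)).trans hik, ?_, s, hs, ?_⟩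
  · intro z hz
    obtain ⟨j, -, rfl⟩ := Finset.mem_image.1 hz
    exact hyI j
  · simpa using hsI

/-- The generic linear combinations `xᵢ = ∑ⱼ Z_{ij} a_j`, `i = 1, …, r`, over the polynomial ring in
all the variables `Z_{ij}`. -/
noncomputable def genericElement {R : Type u} [CommRing R] {t : ℕ} (a : Fin t → R) (r : ℕ)
    (i : Fin r) : MvPolynomial (Fin r × Fin t) R :=
  ∑ j, MvPolynomial.X (i, j) * MvPolynomial.C (a j)

theorem eval_genericElement {R : Type u} [CommRing R] {t : ℕ} (a : Fin t → R) {r : ℕ}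
    (c : Fin r × Fin t → R) (i : Fin r) :
    MvPolynomial.eval c (genericElement a r i) = ∑ j, c (i, j) * a j := by
  simp [genericElement]

/-- Adjoining one more row of variables to `R[Z_{ij} : i ≤ r]`. -/
noncomputable def addRowEquiv (R : Type u) [CommRing R] (r t : ℕ) :
    MvPolynomial (Fin t) (MvPolynomial (Fin r × Fin t) R) ≃+* MvPolynomial (Fin (r + 1) × Fin t) R :=
  (MvPolynomial.sumRingEquiv R (Fin t) (Fin r × Fin t)).symm.trans
    (MvPolynomial.renameEquiv R (Equiv.ofBijective
      (Sum.elim (fun j => (Fin.last r, j)) fun q => (q.1.castSucc, q.2) :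
        Fin t ⊕ Fin r × Fin t → Fin (r + 1) × Fin t) (by
          constructor
          · rintro (j | ⟨i, j⟩) (j' | ⟨i', j'⟩) h
            · simpa using h
            · exact absurd (congrArg Prod.fst h).symm (Fin.castSucc_lt_last i').ne
            · exact absurd (congrArg Prod.fst h) (Fin.castSucc_lt_last i).ne
            · simpa using h
          · rintro ⟨i, j⟩
            induction i using Fin.lastCases with
            | last => exact ⟨Sum.inl j, rfl⟩
            | cast i => exact ⟨Sum.inr (i, j), rfl⟩))).toRingEquiv

theorem addRowEquiv_C_C {R : Type u} [CommRing R] (r t : ℕ) (c : R) :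
    addRowEquiv R r t (MvPolynomial.C (MvPolynomial.C c)) = MvPolynomial.C c := by
  simp [addRowEquiv]

theorem addRowEquiv_X {R : Type u} [CommRing R] (r t : ℕ) (j : Fin t) :
    addRowEquiv R r t (MvPolynomial.X j) = MvPolynomial.X (Fin.last r, j) := by
  simp [addRowEquiv]
  rfl

theorem addRowEquiv_C_X {R : Type u} [CommRing R] (r t : ℕ) (i : Fin r) (j : Fin t) :
    addRowEquiv R r t (MvPolynomial.C (MvPolynomial.X (i, j))) =
      MvPolynomial.X (i.castSucc, j) := by
  simp [addRowEquiv]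
  rfl

/-- Under `G_d`, modulo `r` generic elements `I` needs at most `ht P - r` generators at each prime
`P` of height less than `d`. -/
theorem residualGeneratorBound_generic {R : Type u} [CommRing R] {I : Ideal R} {d t : ℕ}
    (hI : ResidualGeneratorBound I ⊥ d 0) (a : Fin t → R) (ha : Ideal.span (Set.range a) = I)
    (r : ℕ) : ResidualGeneratorBound (I.map (MvPolynomial.C : R →+* MvPolynomial (Fin r × Fin t) R))
      (Ideal.span (Set.range (genericElement a r))) d r := by
  induction r with
  | zero =>
    have h := (hI.map_equiv (MvPolynomial.isEmptyRingEquiv R (Fin 0 × Fin t)).symm).mono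
      (J' := Ideal.span (Set.range (genericElement a 0))) (by rw [Ideal.map_bot]; exact bot_le)
    convert h using 2
    exact (MvPolynomial.isEmptyRingEquiv_symm_toRingHom _).symm
  | succ r ih =>
    have ha' : Ideal.span (Set.range fun j => (MvPolynomial.C (a j) :
        MvPolynomial (Fin r × Fin t) R)) = I.map MvPolynomial.C := by
      rw [← ha, Ideal.map_span, ← Set.range_comp]
      rfl
    have h := ((ih.step _ ha').map_equiv (addRowEquiv R r t)).mono
      (J' := Ideal.span (Set.range (genericElement a (r + 1)))) ?_
    · rw [Ideal.map_map, Ideal.map_map] at h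
      convert h using 2
      ext c
      simp [addRowEquiv_C_C]
    · rw [Ideal.map_sup, Ideal.map_map, Ideal.map_span, Ideal.map_span, sup_le_iff]
      constructor
      · rw [Ideal.span_le]
        rintro _ ⟨_, ⟨i, rfl⟩, rfl⟩
        refine Ideal.subset_span ⟨i.castSucc, ?_⟩
        simp [genericElement, addRowEquiv_C_C, addRowEquiv_C_X]
      · rw [Ideal.span_le]
        rintro _ ⟨_, rfl, rfl⟩
        refine Ideal.subset_span ⟨Fin.last r, ?_⟩
        simp [genericElement, addRowEquiv_C_C, addRowEquiv_X]

/-- Under `G_{n+1}`, `n` general elements of `I` generate `I` on the punctured spectrum: the colon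
ideal `C = (x₁, …, x_n) : I` satisfies `𝔪ˢ ⊆ I + C`. The exponent `s` is obtained for generic
elements and specialized. -/
theorem exists_polynomial_pow_le_sup_colon {R : Type u} [CommRing R] [IsNoetherianRing R]
    [IsLocalRing R] {n : ℕ} (hdim : ringKrullDim R = (n + 1 : ℕ)) {I : Ideal R}
    (hG : SatisfiesG I (n + 1)) {t : ℕ} (a : Fin t → R) (ha : Ideal.span (Set.range a) = I) :
    ∃ f : MvPolynomial (Fin n × Fin t) R, f ∉ (IsLocalRing.maximalIdeal R).map MvPolynomial.C ∧
      ∃ s : ℕ, ∀ c : Fin n × Fin t → R, IsUnit (MvPolynomial.eval c f) →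
        IsLocalRing.maximalIdeal R ^ s ≤
          I ⊔ (Ideal.span (Set.range fun i => ∑ j, c (i, j) * a j)).colon (I : Set R) := by
  set M : Ideal (MvPolynomial (Fin n × Fin t) R) :=
    (IsLocalRing.maximalIdeal R).map MvPolynomial.C with hM
  have hMp : M.IsPrime := MvPolynomial.isPrime_map_C _
  have hMht : M.height ≤ (n + 1 : ℕ) := by
    refine (height_map_C_le _).trans ?_
    have := IsLocalRing.maximalIdeal_height_eq_ringKrullDim (R := R)
    rw [hdim] at this
    exact le_of_eq (by exact_mod_cast this)
  have hbound := residualGeneratorBound_generic (residualGeneratorBound_of_satisfiesG hG) a ha n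
  set J : Ideal (MvPolynomial (Fin n × Fin t) R) := Ideal.span (Set.range (genericElement a n))
  obtain ⟨f, hf, s, hfs⟩ := exists_notMem_mul_pow_mem (P := M)
    (𝔟 := I.map MvPolynomial.C ⊔
      J.colon ((I.map MvPolynomial.C : Ideal (MvPolynomial (Fin n × Fin t) R)) : Set _)) (𝔠 := M) (by
      intro Q hQ hle hQM
      by_contra hne
      have hlt := Ideal.height_add_one_le_of_lt_of_isPrime (lt_of_le_not_ge hQM hne)
      have hht : Q.height ≤ n := by
        have h1 : Q.height + 1 ≤ n + 1 := by exact_mod_cast hlt.trans hMht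
        exact (ENat.add_le_add_iff_right ENat.one_ne_top).1 h1
      obtain ⟨T, hT, -, s, hs, hsI⟩ := hbound Q hQ (le_sup_left.trans hle) n hht n.lt_succ_self
      rw [Nat.sub_self, Nat.le_zero, Finset.card_eq_zero] at hT
      subst hT
      refine hs (hle (Ideal.mem_sup_right (Submodule.mem_colon.2 fun z hz => ?_)))
      simpa using hsI z hz)
  refine ⟨f, hf, s, fun c hc r hr => ?_⟩
  have hr' : MvPolynomial.C r ∈ M ^ s := by
    rw [hM, ← Ideal.map_pow]
    exact Ideal.mem_map_of_mem _ hr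
  obtain ⟨u, hu, v, hv, huv⟩ := Submodule.mem_sup.1 (hfs _ hr')
  have hev := congrArg (MvPolynomial.eval c) huv
  rw [map_add, map_mul, MvPolynomial.eval_C] at hev
  have hu' : MvPolynomial.eval c u ∈ I := by
    have : I.map MvPolynomial.C ≤ I.comap (MvPolynomial.eval c) := by
      rw [Ideal.map_le_iff_le_comap]
      intro z hz
      simpa using hz
    exact this hu
  have hJ : J ≤ (Ideal.span (Set.range fun i => ∑ j, c (i, j) * a j)).comap
      (MvPolynomial.eval c) := by
    refine Ideal.span_le.2 ?_
    rintro _ ⟨i, rfl⟩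
    rw [SetLike.mem_coe, Ideal.mem_comap, eval_genericElement]
    exact Ideal.subset_span ⟨i, rfl⟩
  have hv' : MvPolynomial.eval c v ∈
      (Ideal.span (Set.range fun i => ∑ j, c (i, j) * a j)).colon (I : Set R) := by
    rw [Submodule.mem_colon]
    intro z hz
    have h1 := hJ (Submodule.mem_colon.1 hv (MvPolynomial.C z) (Ideal.mem_map_of_mem _ hz))
    simpa using h1
  refine (Ideal.unit_mul_mem_iff_mem _ hc).1 ?_
  rw [← hev]
  exact Ideal.add_mem _ (Ideal.mem_sup_left hu') (Ideal.mem_sup_right hv')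

/-! ### General elements generate a reduction -/

/-- If `(x₁, …, x_r)` with `xᵢ = ∑ⱼ c₀(i,j) a_j` satisfies `Iᵐ⁺¹ = (x₁, …, x_r) Iᵐ` modulo
`𝔪 Iᵐ⁺¹`, then the equality holds for general linear combinations. By Nakayama's lemma, generic
elements satisfy it up to a factor `f` that does not vanish at the residue class of `c₀`. -/
theorem exists_polynomial_pow_succ_eq {R : Type u} [CommRing R] [IsNoetherianRing R]
    [IsLocalRing R] {I : Ideal R} {r t : ℕ} (a : Fin t → R) (ha : Ideal.span (Set.range a) = I)
    (c₀ : Fin r × Fin t → R) (m : ℕ)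
    (h : I ^ (m + 1) ≤ Ideal.span (Set.range fun i => ∑ j, c₀ (i, j) * a j) * I ^ m ⊔
      IsLocalRing.maximalIdeal R * I ^ (m + 1)) :
    ∃ f : MvPolynomial (Fin r × Fin t) R, f ∉ (IsLocalRing.maximalIdeal R).map MvPolynomial.C ∧
      ∀ c : Fin r × Fin t → R, IsUnit (MvPolynomial.eval c f) →
        I ^ (m + 1) = Ideal.span (Set.range fun i => ∑ j, c (i, j) * a j) * I ^ m := by
  have haI : ∀ j, a j ∈ I := fun j => ha ▸ Ideal.subset_span ⟨j, rfl⟩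
  set I' : Ideal (MvPolynomial (Fin r × Fin t) R) := I.map MvPolynomial.C with hI'
  set J : Ideal (MvPolynomial (Fin r × Fin t) R) := Ideal.span (Set.range (genericElement a r))
  set 𝔫 : Ideal (MvPolynomial (Fin r × Fin t) R) :=
    (IsLocalRing.maximalIdeal R).comap (MvPolynomial.eval c₀) with h𝔫
  have hm𝔫 : (IsLocalRing.maximalIdeal R).map MvPolynomial.C ≤ 𝔫 := by
    rw [Ideal.map_le_iff_le_comap]
    intro z hz
    simpa [h𝔫] using hz
  have hJ : (Ideal.span (Set.range fun i => ∑ j, c₀ (i, j) * a j)).map MvPolynomial.C ≤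
      J ⊔ 𝔫 * I' := by
    rw [Ideal.map_span, Ideal.span_le]
    rintro _ ⟨_, ⟨i, rfl⟩, rfl⟩
    have h1 : (MvPolynomial.C (∑ j, c₀ (i, j) * a j) : MvPolynomial (Fin r × Fin t) R) =
        genericElement a r i + ∑ j, (MvPolynomial.C (c₀ (i, j)) - MvPolynomial.X (i, j)) *
          MvPolynomial.C (a j) := by
      rw [genericElement, ← Finset.sum_add_distrib, map_sum]
      refine Finset.sum_congr rfl fun j _ => ?_
      rw [map_mul]
      ring
    change MvPolynomial.C (∑ j, c₀ (i, j) * a j) ∈ J ⊔ 𝔫 * I'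
    rw [h1]
    refine Ideal.add_mem _ (Ideal.mem_sup_left (Ideal.subset_span ⟨i, rfl⟩))
      (Ideal.mem_sup_right (Ideal.sum_mem _ fun j _ => Ideal.mul_mem_mul ?_
        (Ideal.mem_map_of_mem _ (haI j))))
    simp [h𝔫]
  have hle : I' ^ (m + 1) ≤ J * I' ^ m ⊔ 𝔫 • I' ^ (m + 1) := by
    have h1 := Ideal.map_mono (f := (MvPolynomial.C : R →+* MvPolynomial (Fin r × Fin t) R)) h
    rw [Ideal.map_sup, Ideal.map_mul, Ideal.map_mul, Ideal.map_pow, Ideal.map_pow] at h1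
    refine h1.trans (sup_le ?_ ((Ideal.mul_mono_left hm𝔫).trans le_sup_right))
    refine (Ideal.mul_mono_left hJ).trans ?_
    rw [Ideal.sup_mul, mul_assoc, ← pow_succ']
    exact le_rfl
  obtain ⟨f, hf1, hf⟩ := Submodule.exists_sub_one_mem_and_smul_le_of_fg_of_le_sup
    (IsNoetherian.noetherian _) le_rfl hle
  refine ⟨f, fun hfm => ?_, fun c hc => le_antisymm (fun z hz => ?_) ?_⟩
  · have h1 : (1 : MvPolynomial (Fin r × Fin t) R) ∈ 𝔫 := by
      simpa using 𝔫.sub_mem (hm𝔫 hfm) hf1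
    rw [h𝔫, Ideal.mem_comap, map_one] at h1
    exact (Ideal.ne_top_iff_one _).1 Ideal.IsPrime.ne_top' h1
  · have hz' : MvPolynomial.C z ∈ I' ^ (m + 1) := by
      rw [hI', ← Ideal.map_pow]
      exact Ideal.mem_map_of_mem _ hz
    have h1 : f * MvPolynomial.C z ∈ J * I' ^ m := hf (Submodule.smul_mem_pointwise_smul _ f _ hz')
    have h2 := Ideal.mem_map_of_mem (MvPolynomial.eval c) h1
    have h3 : I'.map (MvPolynomial.eval c) = I := by
      rw [hI', Ideal.map_map]
      convert Ideal.map_id I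
      ext z
      simp
    have h4 : J.map (MvPolynomial.eval c) =
        Ideal.span (Set.range fun i => ∑ j, c (i, j) * a j) := by
      rw [Ideal.map_span, ← Set.range_comp]
      congr 2
      ext i
      exact eval_genericElement a c i
    rw [Ideal.map_mul, Ideal.map_pow, h3, h4, map_mul, MvPolynomial.eval_C] at h2
    exact (Ideal.unit_mul_mem_iff_mem _ hc).1 h2
  · rw [pow_succ']
    refine Ideal.mul_mono_left (Ideal.span_le.2 ?_)
    rintro _ ⟨i, rfl⟩
    exact I.sum_mem fun j _ => I.mul_mem_left _ (haI j)

/-- Prime avoidance by linear forms: over an infinite residue field, finitely many primes of the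
special fiber ring that do not contain all linear forms are avoided by a single linear form. -/
theorem exists_linear_notMem {R : Type u} [CommRing R] [IsNoetherianRing R] [IsLocalRing R]
    [Infinite (IsLocalRing.ResidueField R)] (I : Ideal R) (S : Finset (Ideal (SpecialFiberRing I)))
    (hS : ∀ P ∈ S, ∃ a : I, fiberMap I (reesLinear I a) ∉ P) :
    ∃ a : I, ∀ P ∈ S, fiberMap I (reesLinear I a) ∉ P := by
  classical
  obtain ⟨t, a, ha⟩ : ∃ (t : ℕ) (a : Fin t → I), Submodule.span R (Set.range a) = ⊤ :=
    Submodule.fg_iff_exists_fin_generating_family.1 (IsNoetherian.noetherian (⊤ : Submodule R I))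
  let V : Ideal (SpecialFiberRing I) →
      Subspace (IsLocalRing.ResidueField R) (Fin t → IsLocalRing.ResidueField R) := fun P =>
    { carrier := {v | ∑ j, fiberScalar I (v j) * fiberMap I (reesLinear I (a j)) ∈ P}
      zero_mem' := by simp
      add_mem' := fun {v w} hv hw => by
        change ∑ j, _ ∈ P
        simp only [Pi.add_apply, map_add, add_mul, Finset.sum_add_distrib]
        exact P.add_mem hv hw
      smul_mem' := fun c v hv => by
        change ∑ j, _ ∈ P
        simp only [Pi.smul_apply, smul_eq_mul, map_mul, mul_assoc, ← Finset.mul_sum]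
        exact P.mul_mem_left _ hv }
  have hlin : ∀ c : Fin t → R, fiberMap I (reesLinear I (∑ j, c j • a j)) =
      ∑ j, fiberScalar I (IsLocalRing.residue R (c j)) * fiberMap I (reesLinear I (a j)) := by
    intro c
    simp only [map_sum, map_smul, Algebra.smul_def, map_mul, fiberScalar_residue]
  have htop : ⊤ ∉ S.image V := by
    intro hmem
    obtain ⟨P, hP, hPV⟩ := Finset.mem_image.1 hmem
    obtain ⟨b, hb⟩ := hS P hP
    have hb' : b ∈ Submodule.span R (Set.range a) := ha ▸ Submodule.mem_top
    obtain ⟨c, rfl⟩ := (Submodule.mem_span_range_iff_exists_fun R).1 hb'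
    rw [hlin] at hb
    have : (fun j => IsLocalRing.residue R (c j)) ∈ V P := hPV ▸ Submodule.mem_top
    exact hb this
  obtain ⟨v, hv⟩ := (Set.ne_univ_iff_exists_notMem _).1
    (Subspace.biUnion_ne_univ_of_top_notMem htop)
  choose c hc using fun j => IsLocalRing.residue_surjective (v j)
  refine ⟨∑ j, c j • a j, fun P hP hmem => hv ?_⟩
  rw [hlin] at hmem
  simp only [hc] at hmem
  exact Set.mem_biUnion (Finset.mem_coe.2 (Finset.mem_image_of_mem V hP)) hmem

/-- There are linear forms such that every prime containing the first `i` of them contains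
all linear forms or has height at least `i`. -/
theorem exists_linear_forms {R : Type u} [CommRing R] [IsNoetherianRing R] [IsLocalRing R]
    [Infinite (IsLocalRing.ResidueField R)] (I : Ideal R) (i : ℕ) :
    ∃ x : Fin i → I, ∀ P : Ideal (SpecialFiberRing I), P.IsPrime →
      (∀ l, fiberMap I (reesLinear I (x l)) ∈ P) →
      (∀ a, fiberMap I (reesLinear I a) ∈ P) ∨ (i : ℕ∞) ≤ P.height := by
  classical
  have hnoeth : IsNoetherianRing (SpecialFiberRing I) :=
    isNoetherianRing_of_surjective _ _ (fiberMap I) (fiberMap_surjective I)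
  induction i with
  | zero => exact ⟨Fin.elim0, fun P _ _ => Or.inr (by simp)⟩
  | succ i ih =>
    obtain ⟨x, hx⟩ := ih
    set L : Ideal (SpecialFiberRing I) :=
      Ideal.span (Set.range fun l => fiberMap I (reesLinear I (x l)))
    obtain ⟨b, hb⟩ := exists_linear_notMem I
      ((Ideal.finite_minimalPrimes_of_isNoetherianRing _ L).toFinset.filter
        fun P => ∃ a, fiberMap I (reesLinear I a) ∉ P) (fun P hP => (Finset.mem_filter.1 hP).2)
    refine ⟨Fin.snoc x b, fun P hP hPx => ?_⟩
    have hLP : L ≤ P := by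
      refine Ideal.span_le.2 ?_
      rintro _ ⟨l, rfl⟩
      simpa using hPx l.castSucc
    obtain ⟨Q, hQ, hQP⟩ := Ideal.exists_minimalPrimes_le hLP
    have hQp := hQ.1.1
    by_cases hQa : ∃ a, fiberMap I (reesLinear I a) ∉ Q
    · right
      have hbQ := hb Q (Finset.mem_filter.2 ⟨by simpa using hQ, hQa⟩)
      have hbP : fiberMap I (reesLinear I b) ∈ P := by simpa using hPx (Fin.last i)
      have hne : Q ≠ P := fun h => hbQ (h ▸ hbP)
      have h1 := Ideal.height_add_one_le_of_lt_of_isPrime (lt_of_le_of_ne hQP hne)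
      have h2 : (i : ℕ∞) ≤ Q.height := by
        refine (hx Q hQp fun l => hQ.1.2 (Ideal.subset_span ⟨l, rfl⟩)).resolve_left ?_
        push Not
        exact hQa
      rw [Nat.cast_succ]
      refine le_trans ?_ h1
      gcongr
    · push Not at hQa
      exact Or.inl fun a => hQP (hQa a)

theorem reesMonomial_mem_span_pow {R : Type u} [CommRing R] (I : Ideal R) (k : ℕ)
    (b : (I ^ k : Ideal R)) :
    reesMonomial I k b ∈ Ideal.span (Set.range (reesLinear I)) ^ k := by
  induction k with
  | zero => simp
  | succ k ih =>
    obtain ⟨b, hb⟩ := b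
    suffices h : ∀ b ∈ I ^ k * I, ∃ hb : b ∈ I ^ (k + 1), reesMonomial I (k + 1) ⟨b, hb⟩ ∈
        Ideal.span (Set.range (reesLinear I)) ^ (k + 1) from (h b (pow_succ I k ▸ hb)).2
    intro b hb
    refine Submodule.mul_induction_on hb (fun u hu v hv => ?_) ?_
    · refine ⟨pow_succ I k ▸ Ideal.mul_mem_mul hu hv, ?_⟩
      rw [reesMonomial_mul I hu (by rwa [pow_one]), pow_succ]
      exact Ideal.mul_mem_mul (ih ⟨u, hu⟩) (Ideal.subset_span ⟨⟨v, hv⟩, rfl⟩)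
    · rintro u v ⟨hu, hu'⟩ ⟨hv, hv'⟩
      exact ⟨Ideal.add_mem _ hu hv, (map_add (reesMonomial I (k + 1)) ⟨u, hu⟩ ⟨v, hv⟩).symm ▸
        Ideal.add_mem _ hu' hv'⟩

theorem coeff_mem_of_mem_map_algebraMap {R : Type u} [CommRing R] {I 𝔞 : Ideal R}
    {z : reesAlgebra I} (hz : z ∈ 𝔞.map (algebraMap R (reesAlgebra I))) (k : ℕ) :
    (z : Polynomial R).coeff k ∈ 𝔞 * I ^ k := by
  induction hz using Submodule.span_induction generalizing k with
  | mem z hz =>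
    obtain ⟨c, hc, rfl⟩ := hz
    change (Polynomial.C c).coeff k ∈ _
    rw [Polynomial.coeff_C]
    split_ifs with h
    · subst h
      simpa using hc
    · exact Ideal.zero_mem _
  | zero => simp
  | add y z _ _ hy hz =>
    rw [AddMemClass.coe_add, Polynomial.coeff_add]
    exact Ideal.add_mem _ (hy k) (hz k)
  | smul g z _ hz =>
    rw [smul_eq_mul, MulMemClass.coe_mul, Polynomial.coeff_mul]
    refine Ideal.sum_mem _ fun q hq => ?_
    rw [← Finset.HasAntidiagonal.mem_antidiagonal.1 hq, pow_add, mul_left_comm]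
    exact Ideal.mul_mem_mul (g.2 _) (hz _)

theorem coeff_succ_mem_of_mem_span {R : Type u} [CommRing R] {I : Ideal R} {r : ℕ} (x : Fin r → I)
    {z : reesAlgebra I} (hz : z ∈ Ideal.span (Set.range fun l => reesLinear I (x l))) (k : ℕ) :
    (z : Polynomial R).coeff (k + 1) ∈ Ideal.span (Set.range fun l => (x l : R)) * I ^ k := by
  obtain ⟨g, rfl⟩ := Ideal.mem_span_range_iff_exists_fun.1 hz
  rw [AddSubmonoidClass.coe_finsetSum, Polynomial.finsetSum_coeff]
  refine Ideal.sum_mem _ fun l _ => ?_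
  rw [MulMemClass.coe_mul, coe_reesLinear, ← Polynomial.C_mul_X_eq_monomial, ← mul_assoc,
    Polynomial.coeff_mul_X, Polynomial.coeff_mul_C, mul_comm ((g l : Polynomial R).coeff k)]
  exact Ideal.mul_mem_mul (Ideal.subset_span ⟨l, rfl⟩) ((g l).2 k)

/-- `ℓ(I)` suitable elements generate a reduction of `I`: their images in the special fiber ring
generate an ideal primary to the irrelevant ideal. -/
theorem exists_pow_succ_le {R : Type u} [CommRing R] [IsNoetherianRing R] [IsLocalRing R]
    [Infinite (IsLocalRing.ResidueField R)] {I : Ideal R} (hIm : I ≤ IsLocalRing.maximalIdeal R)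
    {d : ℕ} (hl : analyticSpread I = d) :
    ∃ (x : Fin d → I) (m : ℕ), I ^ (m + 1) ≤ Ideal.span (Set.range fun l => (x l : R)) * I ^ m ⊔
      IsLocalRing.maximalIdeal R * I ^ (m + 1) := by
  obtain ⟨x, hx⟩ := exists_linear_forms I d
  refine ⟨x, ?_⟩
  -- the irrelevant maximal ideal of the Rees algebra
  let ε : reesAlgebra I →+* IsLocalRing.ResidueField R :=
    ((IsLocalRing.residue R).comp Polynomial.constantCoeff).comp
      (reesAlgebra I).toSubring.subtype
  have hε : ∀ z : reesAlgebra I, z ∈ RingHom.ker ε ↔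
      (z : Polynomial R).coeff 0 ∈ IsLocalRing.maximalIdeal R := fun z => by
    rw [RingHom.mem_ker, ← IsLocalRing.residue_eq_zero_iff]
    rfl
  have hεp : (RingHom.ker ε).IsPrime := RingHom.ker_isPrime ε
  set 𝔟 : Ideal (reesAlgebra I) :=
    (IsLocalRing.maximalIdeal R).map (algebraMap R (reesAlgebra I)) ⊔
      Ideal.span (Set.range fun l => reesLinear I (x l)) with h𝔟
  have hcomap : ∀ Q : Ideal (reesAlgebra I), RingHom.ker (fiberMap I) ≤ Q →
      (Q.map (fiberMap I)).comap (fiberMap I) = Q := fun Q hQ => by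
    rw [Ideal.comap_map_of_surjective _ (fiberMap_surjective I), ← RingHom.ker_eq_comap_bot,
      sup_eq_left.2 hQ]
  have hlinε : ∀ a, reesLinear I a ∈ RingHom.ker ε := fun a => by
    rw [hε, coe_reesLinear, Polynomial.coeff_monomial, if_neg one_ne_zero]
    exact Ideal.zero_mem _
  obtain ⟨g, hg, s, hgs⟩ := exists_notMem_mul_pow_mem (P := RingHom.ker ε) (𝔟 := 𝔟)
    (𝔠 := Ideal.span (Set.range (reesLinear I))) (by
      intro Q hQ hbQ hQε
      rw [Ideal.span_le]
      rintro _ ⟨a, rfl⟩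
      have hkQ : RingHom.ker (fiberMap I) ≤ Q := (ker_fiberMap hIm).le.trans (le_sup_left.trans hbQ)
      have hQ' : (Q.map (fiberMap I)).IsPrime :=
        Ideal.map_isPrime_of_surjective (fiberMap_surjective I) hkQ
      have hxQ : ∀ l, fiberMap I (reesLinear I (x l)) ∈ Q.map (fiberMap I) := fun l =>
        Ideal.mem_map_of_mem _ (hbQ (Ideal.mem_sup_right (Ideal.subset_span ⟨l, rfl⟩)))
      rcases hx _ hQ' hxQ with h | h
      · have := h a
        rwa [← Ideal.mem_comap, hcomap Q hkQ] at this
      · by_cases hne : Q = RingHom.ker ε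
        · exact hne ▸ hlinε a
        · exfalso
          have hε' : ((RingHom.ker ε).map (fiberMap I)).IsPrime :=
            Ideal.map_isPrime_of_surjective (fiberMap_surjective I) (hkQ.trans hQε)
          have hlt : Q.map (fiberMap I) < (RingHom.ker ε).map (fiberMap I) := by
            refine lt_of_le_of_ne (Ideal.map_mono hQε) fun he => hne ?_
            rw [← hcomap Q hkQ, he, hcomap _ (hkQ.trans hQε)]
          have h1 := Ideal.height_add_one_le_of_lt_of_isPrime hlt
          have h2 := Ideal.height_le_ringKrullDim_of_ne_top hε'.ne_top
          have h3 : ringKrullDim (SpecialFiberRing I) = d := hl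
          rw [h3] at h2
          have h4 : ((RingHom.ker ε).map (fiberMap I)).height ≤ d := by exact_mod_cast h2
          have h5 : (d : ℕ∞) + 1 ≤ d := by
            refine le_trans ?_ (h1.trans h4)
            gcongr
          exact absurd (by exact_mod_cast h5) (Nat.not_succ_le_self d))
  refine ⟨s, fun b hb => ?_⟩
  have hb𝔠 := Ideal.pow_le_pow_right s.le_succ (reesMonomial_mem_span_pow I (s + 1) ⟨b, hb⟩)
  obtain ⟨u, hu, v, hv, huv⟩ := Submodule.mem_sup.1 (hgs _ hb𝔠)
  have hcoeff := congrArg (fun z : reesAlgebra I => (z : Polynomial R).coeff (s + 1)) huv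
  simp only [AddMemClass.coe_add, MulMemClass.coe_mul, Polynomial.coeff_add,
    coe_reesMonomial] at hcoeff
  rw [← Polynomial.C_mul_X_pow_eq_monomial, ← mul_assoc] at hcoeff
  have h0 : ((g : Polynomial R) * Polynomial.C b * Polynomial.X ^ (s + 1)).coeff (s + 1) =
      (g : Polynomial R).coeff 0 * b := by
    have := Polynomial.coeff_mul_X_pow ((g : Polynomial R) * Polynomial.C b) (s + 1) 0
    rwa [zero_add, Polynomial.coeff_mul_C] at this
  rw [h0] at hcoeff
  have hunit : IsUnit ((g : Polynomial R).coeff 0) := by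
    by_contra h
    exact hg ((hε g).2 ((IsLocalRing.mem_maximalIdeal _).2 h))
  refine (Ideal.unit_mul_mem_iff_mem _ hunit).1 ?_
  rw [← hcoeff]
  exact Ideal.add_mem _ (Ideal.mem_sup_right (coeff_mem_of_mem_map_algebraMap hu _))
    (Ideal.mem_sup_left (coeff_succ_mem_of_mem_span x hv s))

/-! ### General elements -/

theorem isUnit_eval_iff {R : Type u} [CommRing R] [IsLocalRing R] {σ : Type*}
    (f : MvPolynomial σ R) (c : σ → R) :
    IsUnit (MvPolynomial.eval c f) ↔ MvPolynomial.eval (fun q => IsLocalRing.residue R (c q))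
      (MvPolynomial.map (IsLocalRing.residue R) f) ≠ 0 := by
  have h : MvPolynomial.eval (fun q => IsLocalRing.residue R (c q))
      (MvPolynomial.map (IsLocalRing.residue R) f) =
        IsLocalRing.residue R (MvPolynomial.eval c f) := by
    rw [MvPolynomial.eval_map]
    exact (MvPolynomial.eval₂_comp_left (IsLocalRing.residue R) (RingHom.id R) c f).symm
  rw [h, IsLocalRing.residue_ne_zero_iff_isUnit]

/-- A principal open set is dense, because `k` is infinite. -/
theorem isZariskiDense_ne_zero {k : Type*} [Field k] [Infinite k] {σ : Type*}
    {f : MvPolynomial σ k} (hf : f ≠ 0) : IsZariskiDense {v | MvPolynomial.eval v f ≠ 0} := by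
  rintro _ ⟨S, rfl⟩ ⟨v, g, hg, hgv⟩
  have hg0 : g ≠ 0 := by
    rintro rfl
    exact hgv (map_zero _)
  by_contra hempty
  refine mul_ne_zero hf hg0 (MvPolynomial.funext fun w => ?_)
  rw [map_mul, map_zero]
  by_contra hne
  exact hempty ⟨w, left_ne_zero_of_mul hne, g, hg, right_ne_zero_of_mul hne⟩

/-- To prove a property for general elements it suffices to find a polynomial `f` over `R`, nonzero
modulo the maximal ideal, such that the property holds whenever `f(c)` is a unit. -/
theorem forGeneralElements_of_exists_polynomial {R : Type u} [CommRing R] [IsLocalRing R]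
    [Infinite (IsLocalRing.ResidueField R)] {I : Ideal R} {s : ℕ} {P : (Fin s → R) → Prop}
    (h : ∀ (t : ℕ) (a : Fin t → R), Ideal.span (Set.range a) = I →
      ∃ f : MvPolynomial (Fin s × Fin t) R, f ∉ (IsLocalRing.maximalIdeal R).map MvPolynomial.C ∧
        ∀ c : Fin s × Fin t → R, IsUnit (MvPolynomial.eval c f) → P fun i => ∑ j, c (i, j) * a j) :
    ForGeneralElements I s P := by
  intro t a ha
  obtain ⟨f, hf, hP⟩ := h t a ha
  have hf0 : MvPolynomial.map (IsLocalRing.residue R) f ≠ 0 := fun h0 => hf <| by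
    rw [← IsLocalRing.ker_residue, ← MvPolynomial.ker_map]
    exact h0
  exact ⟨{v | MvPolynomial.eval v (MvPolynomial.map (IsLocalRing.residue R) f) ≠ 0},
    ⟨{MvPolynomial.map (IsLocalRing.residue R) f}, by simp⟩, isZariskiDense_ne_zero hf0,
    fun c hc => hP c ((isUnit_eval_iff f c).2 hc)⟩

theorem le_maximalIdeal_of_analyticSpread {R : Type u} [CommRing R] [IsLocalRing R] {I : Ideal R}
    {d : ℕ} (hl : analyticSpread I = d) : I ≤ IsLocalRing.maximalIdeal R := by
  refine IsLocalRing.le_maximalIdeal fun htop => ?_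
  have h1 : (1 : reesAlgebra I) ∈ RingHom.ker (gradedMap I) := by
    rw [ker_gradedMap, htop, Ideal.map_top]
    exact Submodule.mem_top
  have h2 : fiberMap I 1 = 0 := by
    have : gradedMap I 1 = 0 := h1
    rw [fiberMap, RingHom.comp_apply, this, map_zero]
  have : Subsingleton (SpecialFiberRing I) :=
    subsingleton_of_zero_eq_one (by rw [← h2, map_one])
  rw [analyticSpread, ringKrullDim_eq_bot_of_subsingleton] at hl
  exact absurd hl.symm (by simp)

theorem initialIdeal_succ {R : Type u} [CommRing R] {n : ℕ} (x : Fin (n + 1) → R) :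
    initialIdeal x n = Ideal.span (Set.range fun i : Fin n => x i.castSucc) := by
  refine congrArg Ideal.span (Set.ext fun y => ⟨?_, ?_⟩)
  · rintro ⟨j, hj, rfl⟩
    exact ⟨⟨j, hj⟩, rfl⟩
  · rintro ⟨i, rfl⟩
    exact ⟨i.castSucc, by simp, rfl⟩

theorem proposition2p2 {R : Type u} [CommRing R] [IsNoetherianRing R] [IsLocalRing R]
    [Infinite (IsLocalRing.ResidueField R)] (d : ℕ) (hd : 1 ≤ d) (hdim : ringKrullDim R = d)
    (I : Ideal R) (hl : analyticSpread I = d) (hG : SatisfiesG I d) :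
    ForGeneralElements I d (fun x =>
      ∃ (_ : IsLocalRing (R ⧸ residualIdeal I x)) (e : ℕ → ℤ),
        (imageIdeal I x).radical = IsLocalRing.maximalIdeal (R ⧸ residualIdeal I x) ∧
        AreGeneralizedHilbertCoeffs (imageIdeal I x) 1 e ∧
        (∀ n : ℕ, quotLength (I ^ (n + 1)) (fullIdeal x * I ^ n) ≠ ⊤ ∧
          quotLength (residualIdeal I x ⊓ I ^ (n + 1))
            (residualIdeal I x ⊓ (fullIdeal x * I ^ n)) ≠ ⊤) ∧
        (∀ n : ℕ,
          ((quotLength (I ^ (n + 1)) (fullIdeal x * I ^ n)).toNat : ℚ)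
              - ((quotLength (residualIdeal I x ⊓ I ^ (n + 1))
                  (residualIdeal I x ⊓ (fullIdeal x * I ^ n))).toNat : ℚ) =
            backwardDiff (fun m : ℤ => (polynomialOfCoeffs 1 e).eval (m : ℚ)
              - (generalizedHilbertFunction (imageIdeal I x) m : ℚ)) n) ∧
        HasSum (fun n : ℕ =>
          ((quotLength (I ^ (n + 1)) (fullIdeal x * I ^ n)).toNat : ℤ)
            - ((quotLength (residualIdeal I x ⊓ I ^ (n + 1))
                (residualIdeal I x ⊓ (fullIdeal x * I ^ n))).toNat : ℤ)) (e 1)) := by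
  obtain ⟨n, rfl⟩ : ∃ n, d = n + 1 := ⟨d - 1, by omega⟩
  have hIm := le_maximalIdeal_of_analyticSpread hl
  obtain ⟨y, N, hy⟩ := exists_pow_succ_le hIm hl
  refine forGeneralElements_of_exists_polynomial fun t a ha => ?_
  have haI : ∀ j, a j ∈ I := fun j => ha ▸ Ideal.subset_span ⟨j, rfl⟩
  obtain ⟨f, hf, s, hfs⟩ := exists_polynomial_pow_le_sup_colon hdim hG a ha
  have hya : ∀ i, ∃ c : Fin t → R, ∑ j, c j * a j = y i := fun i =>
    Ideal.mem_span_range_iff_exists_fun.1 (ha ▸ (y i).2)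
  choose c₀ hc₀ using hya
  obtain ⟨g, hg, hgred⟩ := exists_polynomial_pow_succ_eq a ha (fun q => c₀ q.1 q.2) N
    (by simpa only [hc₀] using hy)
  -- `f` involves only the coefficients of the first `n` elements
  let ι : Fin n × Fin t → Fin (n + 1) × Fin t := fun q => (q.1.castSucc, q.2)
  have hι : Function.Injective ι :=
    (Fin.castSucc_injective n).prodMap Function.injective_id
  have hM := MvPolynomial.isPrime_map_C (σ := Fin (n + 1) × Fin t) (IsLocalRing.maximalIdeal R)
  refine ⟨MvPolynomial.rename ι f * g, fun hmem => ?_, fun c hc => ?_⟩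
  · rcases hM.mem_or_mem hmem with h | h
    · refine hf (MvPolynomial.mem_map_C_iff.2 fun m => ?_)
      rw [← MvPolynomial.coeff_rename_mapDomain ι hι]
      exact MvPolynomial.mem_map_C_iff.1 h _
    · exact hg h
  · rw [map_mul, MvPolynomial.eval_rename, IsUnit.mul_iff] at hc
    have hs := hfs _ hc.1
    have hred := hgred c hc.2
    have hinit : initialIdeal (fun i => ∑ j, c (i, j) * a j) n =
        Ideal.span (Set.range fun i : Fin n => ∑ j, (c ∘ ι) (i, j) * a j) := initialIdeal_succ _
    rw [← hinit] at hs
    have hC : (initialIdeal (fun i => ∑ j, c (i, j) * a j) n).colon (I : Set R) * I ≤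
        initialIdeal (fun i => ∑ j, c (i, j) * a j) n :=
      Ideal.mul_le.2 fun u hu v hv => Submodule.mem_colon.1 hu v hv
    have hxI : ∀ i, ∑ j, c (i, j) * a j ∈ I := fun i =>
      I.sum_mem fun j _ => I.mul_mem_left _ (haI j)
    exact hilbertCoeffs_of_reduction hIm hxI (residualIdeal_ne_top hIm hl hxI hs hC hred) hs hC hred
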